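/- Let $a\in\mathbb C\setminus\{0,1\}$ and $q,\alpha,\beta,\delta\in\mathbb C$ be fixed. For $\gamma\in\mathbb C$ put $\varepsilon=\alpha+\beta+1-\gamma-\delta$ and consider Heun's equation $$H''(z)+\Bigl(\frac{\gamma}{z}+\frac{\delta}{z-1}+\frac{\varepsilon}{z-a}\Bigr)H'(z)+\frac{\alpha\beta z-q}{z(z-1)(z-a)}H(z)=0.$$ Write $P_n=an(\gamma-1+n)$, $Q_n=q+(n-1)[(a+1)(\gamma+n-2)+\varepsilon+a\delta]$, $R_n=-(n-2+\alpha)(n-2+\beta)$, $S_n=a(1-\gamma-2n)$, $T_n=\varepsilon+a\delta+(a+1)(\gamma+2n-3)$, $U_n=4-2n-\alpha-\beta$. Let $D=\mathbb C\setminus\bigl([1,\infty)\cup a[1,\infty)\bigr)$ and $D'=D\setminus(-\infty,0]$; $\log z$ and $z^{1-\gamma}$ denote principal branches. For $\gamma\notin\{0,-1,-2,\dots\}$ let $\mathrm{HeunL}(\gamma;z)=\mathrm{HeunL}(a,q,\alpha,\beta,\gamma,\delta;z)$ be the analytic continuation to $D$ of $\sum_{n\ge0}b_nz^n$, where $b_{-1}=0$,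 $b_0=1$, $P_nb_n=Q_nb_{n-1}+R_nb_{n-2}$ for $n\geq 1$. Put $$\widetilde{\mathrm{HeunL}}(\gamma;z)=\mathrm{HeunL}\bigl(a,\,q-(\gamma-1)(\varepsilon+a\delta),\,\alpha-\gamma+1,\,\beta-\gamma+1,\,2-\gamma,\,\delta;\,z\bigr),\qquad \mathrm{HeunS}(\gamma;z)=z^{1-\gamma}\,\widetilde{\mathrm{HeunL}}(\gamma;z).$$ Let $\rho(r)=1$ for $r\le0$, $\rho(r)=0$ for $r\ge\frac12$, and $\rho(r)=\dfrac{e^{E}}{1+e^{E}}$ with $E=\frac1{2r}+\frac1{2r-1}$ for $0<r<\frac12$. For an integer $n\ge0$ let $K_n=\dfrac{Q_{n+1}c_n+R_{n+1}c_{n-1}}{a(n+1)}$, everything being computed at $\gamma=-n$, where $c_{-1}=0$, $c_0=1$ and $P_kc_k=Q_kc_{k-1}+R_kc_{k-2}$ for $1\le k\le n$. Define $$\mathrm{HeunL}_\ast(\gamma;z)=\mathrm{HeunL}(\gamma;z)-\frac{K_n}{\gamma+n}\,\rho(|\gamma+n|)\,\mathrm{HeunS}(\gamma;z)\quad\text{if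 }0<|\gamma+n|<\tfrac12\text{ for some integer }n\ge0,$$ extended to $\gamma=-n$ by its limit as $\gamma\to-n$, and $\mathrm{HeunL}_\ast=\mathrm{HeunL}$ for all other $\gamma$. Let $$\mathrm{HeunS}^\circ_\ast(\gamma;z)=z^{1-\gamma}\,\mathrm{HeunL}_\ast\bigl(a,\,q-(\gamma-1)(\varepsilon+a\delta),\,\alpha-\gamma+1,\,\beta-\gamma+1,\,2-\gamma,\,\delta;\,z\bigr).$$ Finally put $\mathrm{HeunS}_\ast=\mathrm{HeunS}^\circ_\ast$ for $|\gamma-1|\ge\frac12$ and, for $0<|\gamma-1|<\frac12$, $$\mathrm{HeunS}_\ast(\gamma;z)=\rho(|\gamma-1|)\,\frac{\mathrm{HeunS}^\circ_\ast(\gamma;z)-\mathrm{HeunL}(\gamma;z)}{1-\gamma}+\bigl(1-\rho(|\gamma-1|)\bigr)\,\mathrm{HeunS}^\circ_\ast(\gamma;z),$$ extended to $\gamma=1$ by its limit as $\gamma\to1$. Then the following hold. 1. The analytic continuations to $D$ defining $\mathrm{HeunL}(\gamma;\cdot)$ for $\gamma\notin\{0,-1,-2,\dots\}$ exist, and for every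 $z\in D'$ the limits used in the definitions of $\mathrm{HeunL}_\ast$ at $\gamma=-n$ and of $\mathrm{HeunS}_\ast$ at $\gamma=1$ exist. 2. For every $z\in D'$ the function $\gamma\mapsto\mathrm{HeunS}_\ast(\gamma;z)$ is $C^\infty$ (in the real sense) on all of $\mathbb C$, in particular at the positive integers. 3. For every $z\in D'$ the functions $\gamma\mapsto\widetilde{\mathrm{HeunL}}(\gamma;z)$ and $\gamma\mapsto\mathrm{HeunL}(\gamma;z)$ are complex differentiable at $\gamma=1$, and $$\mathrm{HeunS}_\ast(1;z)=\lim_{\gamma\to1}\frac{\mathrm{HeunS}(\gamma;z)-\mathrm{HeunL}(\gamma;z)}{1-\gamma}=\log(z)\,\mathrm{HeunL}(1;z)-\Bigl(\frac{\partial\widetilde{\mathrm{HeunL}}}{\partial\gamma}(1;z)-\frac{\partial\mathrm{HeunL}}{\partial\gamma}(1;z)\Bigr).$$ 4. The function in 3 is the logarithmic solution of Heun's equation with $\gamma=1$ on $D'$: it is analytic on $D'$, it satisfies the equation there, and there is a constant $B\in\mathbb C$ such that for all $z\in D'$ $$\mathrm{HeunS}_\ast(1;z)=\sum_{n\ge1}d_nz^n+(\log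 z+B)\,\mathrm{HeunL}(1;z),$$ where $d_{-1}=d_0=0$, $P_nd_n=Q_nd_{n-1}+R_nd_{n-2}+S_nb_n+T_nb_{n-1}+U_nb_{n-2}$ for $n\ge1$ (all at $\gamma=1$), and the power series $\sum d_nz^n$ stands for its analytic continuation to $D$, which exists. -/

import Mathlib

open Filter Topology
open scoped ContDiff

noncomputable section

namespace Heun

/-- The parameter `ε`, determined by the Fuchsian relation `α + β + 1 = γ + δ + ε`. -/
def eps (α β γ δ : ℂ) : ℂ := α + β + 1 - γ - δ

/-- `f` is analytic on `U` and solves Heun's equation there. -/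
def IsSolutionOn (a q α β γ δ : ℂ) (U : Set ℂ) (f : ℂ → ℂ) : Prop :=
  AnalyticOnNhd ℂ f U ∧ ∀ z ∈ U,
    deriv (deriv f) z + (γ / z + δ / (z - 1) + eps α β γ δ / (z - a)) * deriv f z
      + (α * β * z - q) / (z * (z - 1) * (z - a)) * f z = 0

/-! ### Coefficients of the local series at `z = 0` -/

def P (a γ : ℂ) (n : ℕ) : ℂ := a * n * (γ - 1 + n)

def Q (a q α β γ δ : ℂ) (n : ℕ) : ℂ :=
  q + ((n : ℂ) - 1) * ((a + 1) * (γ + n - 2) + eps α β γ δ + a * δ)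

def R (α β : ℂ) (n : ℕ) : ℂ := -(((n : ℂ) - 2 + α) * ((n : ℂ) - 2 + β))

def S (a γ : ℂ) (n : ℕ) : ℂ := a * (1 - γ - 2 * n)

def T (a α β γ δ : ℂ) (n : ℕ) : ℂ :=
  eps α β γ δ + a * δ + (a + 1) * (γ + 2 * n - 3)

def U (α β : ℂ) (n : ℕ) : ℂ := 4 - 2 * (n : ℂ) - α - β

/-- The coefficients `b n` of the local Heun function: `P n * b n = Q n * b (n-1) + R n * b (n-2)`
with `b (-1) = 0`, `b 0 = 1`. If `γ = -m` with `m : ℕ`, only the `b n` with `n ≤ m` are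
meaningful. -/
def coeffL (a q α β γ δ : ℂ) : ℕ → ℂ
  | 0 => 1
  | 1 => Q a q α β γ δ 1 / P a γ 1
  | n + 2 => (Q a q α β γ δ (n + 2) * coeffL a q α β γ δ (n + 1)
      + R α β (n + 2) * coeffL a q α β γ δ n) / P a γ (n + 2)

/-- The coefficients `d n` of the non-logarithmic part of the second solution at `γ = 1`:
`P n * d n = Q n * d (n-1) + R n * d (n-2) + S n * b n + T n * b (n-1) + U n * b (n-2)`
with `d (-1) = d 0 = 0` and `b (-1) = 0`, where `b` are the coefficients of the local Heun
function at `γ = 1`. -/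
def coeffD (a q α β δ : ℂ) : ℕ → ℂ
  | 0 => 0
  | 1 => (S a 1 1 * coeffL a q α β 1 δ 1 + T a α β 1 δ 1 * coeffL a q α β 1 δ 0) / P a 1 1
  | n + 2 => (Q a q α β 1 δ (n + 2) * coeffD a q α β δ (n + 1)
      + R α β (n + 2) * coeffD a q α β δ n
      + S a 1 (n + 2) * coeffL a q α β 1 δ (n + 2)
      + T a α β 1 δ (n + 2) * coeffL a q α β 1 δ (n + 1)
      + U α β (n + 2) * coeffL a q α β 1 δ n) / P a 1 (n + 2)

/-! ### Analytic continuation from `z = 0` to the cut plane -/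

/-- The complex plane cut along the rays from `1` and from `a` to infinity, directed away
from `0`. It is star-shaped with respect to `0`. -/
def starDomain (a : ℂ) : Set ℂ := {z | ∀ t : ℝ, 1 ≤ t → z ≠ (t : ℂ) ∧ z ≠ (t : ℂ) * a}

/-- The star domain with the additional branch cut along the non-positive real axis. -/
def cutDomain (a : ℂ) : Set ℂ := starDomain a ∩ Complex.slitPlane

/-- `f` is an analytic continuation to the star domain of the germ at `0` of the
power series `∑ c n * z ^ n`. -/
def IsContinuation (a : ℂ) (c : ℕ → ℂ) (f : ℂ → ℂ) : Prop :=
  AnalyticOnNhd ℂ f (starDomain a) ∧ ∀ᶠ z in 𝓝 (0 : ℂ), HasSum (fun n => c n * z ^ n) (f z)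

open Classical in
/-- The analytic continuation of `∑ c n * z ^ n` to the star domain (on which it is unique),
with the junk value `0` if there is none. -/
def continuation (a : ℂ) (c : ℕ → ℂ) : ℂ → ℂ :=
  if h : ∃ f, IsContinuation a c f then h.choose else 0

/-- The local Heun function `HeunL(a,q,α,β,γ,δ;z)` for `γ` not in `{0,-1,-2,…}`. -/
def heunL (a q α β γ δ z : ℂ) : ℂ := continuation a (coeffL a q α β γ δ) z

/-- `q' = q - (γ-1)(ε + aδ)`. -/
def qPrime (a q α β γ δ : ℂ) : ℂ := q - (γ - 1) * (eps α β γ δ + a * δ)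

/-- `HeunL` at the transformed parameters `a, q', α-γ+1, β-γ+1, 2-γ, δ`. -/
def heunLTransformed (a q α β γ δ z : ℂ) : ℂ :=
  heunL a (qPrime a q α β γ δ) (α - γ + 1) (β - γ + 1) (2 - γ) δ z

/-- The second local Heun function `HeunS(a,q,α,β,γ,δ;z)` for `γ` not in `{1,2,3,…}`. -/
def heunS (a q α β γ δ z : ℂ) : ℂ := z ^ (1 - γ) * heunLTransformed a q α β γ δ z

/-- The logarithmic second solution at `γ = 1`, with constant `B`:
`∑ d n * z ^ n + (log z + B) * HeunL(z)`, the series being analytically continued. -/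
def heunSLog (a q α β δ B z : ℂ) : ℂ :=
  continuation a (coeffD a q α β δ) z + (Complex.log z + B) * heunL a q α β 1 δ z

/-! ### Regularization -/

/-- The cut-off function. -/
def rho (r : ℝ) : ℝ :=
  if r ≤ 0 then 1
  else if r < 1 / 2 then
    Real.exp (1 / (2 * r) + 1 / (2 * r - 1)) / (1 + Real.exp (1 / (2 * r) + 1 / (2 * r - 1)))
  else 0

/-- The constant `K n = (Q (n+1) * c n + R (n+1) * c (n-1)) / (a * (n+1))`, all quantities being
computed at `γ = -n`, with `c (-1) = 0`. -/
def K (a q α β δ : ℂ) (n : ℕ) : ℂ :=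
  (Q a q α β (-n) δ (n + 1) * coeffL a q α β (-n) δ n
    + R α β (n + 1) * (if n = 0 then 0 else coeffL a q α β (-n) δ (n - 1))) / (a * (n + 1))

/-- The corrected function `HeunL - K n / (γ + n) * ρ(|γ + n|) * HeunS` near `γ = -n`, for
`γ ≠ -n`. -/
def heunLCorrected (n : ℕ) (a q α β γ δ z : ℂ) : ℂ :=
  heunL a q α β γ δ z - K a q α β δ n / (γ + n) * (rho ‖γ + n‖ : ℂ) * heunS a q α β γ δ z

open Classical in
/-- The regularized function `HeunL☼`. In the disc `|γ + n| < 1/2` (there is at most one such `n`)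
it is the corrected function, extended to the centre `γ = -n` by its limit. -/
def heunLReg (a q α β γ δ z : ℂ) : ℂ :=
  if h : ∃ n : ℕ, ‖γ + n‖ < 1 / 2 then
    if γ = -(h.choose : ℂ) then
      limUnder (𝓝[≠] γ) (fun g => heunLCorrected h.choose a q α β g δ z)
    else heunLCorrected h.choose a q α β γ δ z
  else heunL a q α β γ δ z

/-- The function `HeunS°☼`. -/
def heunSRing (a q α β γ δ z : ℂ) : ℂ :=
  z ^ (1 - γ) *
    heunLReg a (qPrime a q α β γ δ) (α - γ + 1) (β - γ + 1) (2 - γ) δ z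

/-- The function used near `γ = 1`, for `γ ≠ 1`. -/
def heunSCorrected (a q α β γ δ z : ℂ) : ℂ :=
  (rho ‖γ - 1‖ : ℂ) * (1 / (1 - γ) * (heunSRing a q α β γ δ z - heunL a q α β γ δ z))
    + (1 - (rho ‖γ - 1‖ : ℂ)) * heunSRing a q α β γ δ z

open Classical in
/-- The regularized function `HeunS☼`. In the disc `|γ - 1| < 1/2` it is the corrected function,
extended to the centre `γ = 1` by its limit. -/
def heunSReg (a q α β γ δ z : ℂ) : ℂ :=
  if ‖γ - 1‖ < 1 / 2 then
    if γ = 1 then limUnder (𝓝[≠] (1 : ℂ)) (fun g => heunSCorrected a q α β g δ z)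
    else heunSCorrected a q α β γ δ z
  else heunSRing a q α β γ δ z

end Heun

end

/-!
The proof rests on one theorem about power series: if the coefficients of a series satisfy Heun's
three-term recurrence, the series continues analytically to the star domain, and if the parameters
of the recurrence and the coefficients depend holomorphically on further variables, so does the
continuation, which may be differentiated term by term. Both claims follow from a single existence
theorem for coefficients in a commutative Banach algebra, applied to the algebra `holAlgebra` of
functions that are continuous on a closed ball of parameters and holomorphic inside it
(`exists_analytic_of_recurrence`, `continuation_parameters`). Over such an algebra, a tail
`∑ c (n + N + 1) z ^ n` of the series and its image under `N + 1 + z d/dz` form the solution `Y` of a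
Fuchsian system `z Y' + (N + 1) Y = (A₀ + z A₁(z)) Y + R(z)`, where `A₁` and `R` are singular at
`1` and `a` only. The operator `N + 1 + z d/dz` is inverted by the mean `∫₀¹ t ^ N g(t z) dt` along
rays, which makes the influence of `A₀` small for large `N`, and the Neumann series converges
locally uniformly on any open set star-shaped about `0` (`exists_fuchs_solution`). Comparison of
coefficients identifies the solution with the tail; no gluing of local continuations is needed.

**Poles in `γ`.** The coefficients `(γ + n) b m` remain regular at `γ = -n`, vanish there for
`m ≤ n` and are `K n` times the coefficients of `HeunS` for `m > n` (`poleTail_of_eq`). Therefore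
`(γ + n) HeunL - K n HeunS` is holomorphic near `γ = -n` and zero at `γ = -n`, for all values of the
other parameters. Its quotient by `γ + n` thus extends holomorphically along any curve of
parameters, and the value at `γ = -n` does not depend on the direction of the curve
(`fderiv_poleDefect`). This matters because `HeunS☼` moves all the parameters with `γ`, while the
limit defining `HeunL☼` moves `γ` alone. The remaining correction carries the factor
`(1 - ρ(|s|)) / s` with `s = γ + n`, which is smooth because `1 - ρ` vanishes to infinite order at `0`
(`contDiff_one_sub_rho_div`). So `HeunL☼` is smooth along holomorphic curves of parameters
(`contDiff_heunLReg`).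

**The point `γ = 1`.** Here `HeunS` and `HeunL` coincide, and their difference quotient has a
removable singularity whose value is computed by the product rule (`heunSQuotient_one`).
Differentiating the recurrences of the two families of coefficients at `γ = 1` and subtracting
gives exactly the recurrence of `d n` (`coeffD_eq`), so by termwise differentiation the
non-logarithmic part of the limit is the continuation of `∑ d n z ^ n`, and the constant `B` is
`0`. Finally, the equation holds near `0` by comparison of coefficients in Euler form and on the
whole domain by the identity theorem (`isSolutionOn_log`).
-/

namespace Heun

/-! ### The cut-off function -/

/-- A real function vanishing on `(-∞, 0]` whose quotients by all powers of the variable are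
smooth; the value at `0` of such a quotient is `0`, by division by zero. -/
def Flat (ψ : ℝ → ℝ) : Prop :=
  (∀ k : ℕ, ContDiff ℝ ∞ fun r => r⁻¹ ^ k * ψ r) ∧ ∀ r ≤ 0, ψ r = 0

lemma Flat.contDiff {ψ : ℝ → ℝ} (h : Flat ψ) : ContDiff ℝ ∞ ψ := by
  simpa using h.1 0

lemma Flat.inv_pow_mul {ψ : ℝ → ℝ} (h : Flat ψ) (m : ℕ) : Flat fun r => r⁻¹ ^ m * ψ r := by
  refine ⟨fun k => ?_, fun r hr => by simp [h.2 r hr]⟩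
  simpa only [pow_add, mul_assoc] using h.1 (k + m)

lemma Flat.const_mul {ψ : ℝ → ℝ} (h : Flat ψ) (c : ℝ) : Flat fun r => c * ψ r := by
  refine ⟨fun k => ?_, fun r hr => by simp [h.2 r hr]⟩
  simpa only [mul_left_comm] using (contDiff_const (c := c)).mul (h.1 k)

lemma Flat.deriv_eq_zero {ψ : ℝ → ℝ} (h : Flat ψ) {r : ℝ} (hr : r ≤ 0) : deriv ψ r = 0 := by
  have h1 : HasDerivWithinAt ψ (deriv ψ r) (Set.Iic 0) r :=
    ((h.contDiff.differentiable (by simp)) r).hasDerivAt.hasDerivWithinAt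
  have h2 : HasDerivWithinAt ψ 0 (Set.Iic 0) r :=
    (hasDerivWithinAt_const r (Set.Iic 0) (0 : ℝ)).congr (fun x hx => h.2 x hx) (h.2 r hr)
  exact (uniqueDiffOn_Iic 0 r hr).eq_deriv _ h1 h2

lemma Flat.deriv {ψ : ℝ → ℝ} (h : Flat ψ) : Flat (deriv ψ) := by
  refine ⟨fun k => ?_, fun r hr => h.deriv_eq_zero hr⟩
  have h1 : ContDiff ℝ ∞ (_root_.deriv fun r => r⁻¹ ^ k * ψ r) :=
    (contDiff_infty_iff_deriv.1 (h.1 k)).2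
  have h2 := h1.add ((contDiff_const (c := (k : ℝ))).mul (h.1 (k + 1)))
  refine (congrArg (ContDiff ℝ ∞) (funext fun r => ?_)).mpr h2
  rcases le_or_gt r 0 with hr | hr
  · have := (h.inv_pow_mul k).deriv_eq_zero hr
    simp only [this, h.deriv_eq_zero hr, h.2 r hr]
    simp
  · have hd := ((hasDerivAt_inv hr.ne').pow k).mul
      ((h.contDiff.differentiable (by simp)) r).hasDerivAt
    have := hd.deriv
    simp only [Pi.mul_def, Pi.pow_def] at this
    rw [this]
    rcases k with _ | k
    · simp
    · rw [Nat.add_sub_cancel, ← inv_pow]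
      ring

/-- A flat function of `√u` is a smooth function of `u`: its derivative is again a flat function
of `√u`. -/
lemma Flat.contDiff_sqrt {ψ : ℝ → ℝ} (h : Flat ψ) : ContDiff ℝ ∞ fun u => ψ √u := by
  have key : ∀ {ψ : ℝ → ℝ}, Flat ψ → ∀ u : ℝ,
      HasDerivAt (fun u => ψ √u) ((√u)⁻¹ ^ 1 * (1 / 2 * _root_.deriv ψ √u)) u := by
    intro ψ h u
    rcases lt_trichotomy u 0 with hu | rfl | hu
    · rw [Real.sqrt_eq_zero_of_nonpos hu.le]
      simp only [inv_zero, pow_one, zero_mul]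
      refine (hasDerivAt_const u (0 : ℝ)).congr_of_eventuallyEq ?_
      filter_upwards [Iio_mem_nhds hu] with v hv
      rw [Real.sqrt_eq_zero_of_nonpos (le_of_lt hv), h.2 0 le_rfl]
    · simp only [Real.sqrt_zero, inv_zero, pow_one, zero_mul]
      rw [hasDerivAt_iff_tendsto_slope_zero]
      have hc : Continuous fun u : ℝ => (√u)⁻¹ ^ 2 * ψ √u :=
        (h.1 2).continuous.comp Real.continuous_sqrt
      have h0 := hc.tendsto 0
      simp only [Real.sqrt_zero, inv_zero] at h0
      norm_num at h0
      refine (h0.mono_left nhdsWithin_le_nhds).congr' ?_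
      filter_upwards [self_mem_nhdsWithin] with v hv
      simp only [zero_add, Real.sqrt_zero, h.2 0 le_rfl, sub_zero, smul_eq_mul]
      rcases le_or_gt v 0 with hv | hv
      · simp [Real.sqrt_eq_zero_of_nonpos hv, h.2 0 le_rfl]
      · rw [Real.sq_sqrt hv.le]
    · have := ((h.contDiff.differentiable (by simp)) √u).hasDerivAt.comp u
        (Real.hasDerivAt_sqrt hu.ne')
      refine this.congr_deriv ?_
      field_simp
  have main : ∀ n : ℕ, ∀ {ψ : ℝ → ℝ}, Flat ψ → ContDiff ℝ n fun u => ψ √u := by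
    intro n
    induction n with
    | zero =>
      intro ψ h
      exact contDiff_zero.2 (h.contDiff.continuous.comp Real.continuous_sqrt)
    | succ n ih =>
      intro ψ h
      push_cast
      rw [contDiff_succ_iff_deriv]
      refine ⟨fun u => (key h u).differentiableAt, by simp, ?_⟩
      rw [show _root_.deriv (fun u => ψ √u) = fun u => (√u)⁻¹ ^ 1 * (1 / 2 * _root_.deriv ψ √u) from
        funext fun u => (key h u).deriv]
      exact ih ((h.deriv.const_mul (1 / 2)).inv_pow_mul 1)
  exact contDiff_infty.2 fun n => main n h

lemma flat_smoothTransition : Flat fun r => Real.smoothTransition (2 * r) := by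
  refine ⟨fun k => ?_, fun r hr => Real.smoothTransition.zero_of_nonpos (by linarith)⟩
  have h1 : ContDiff ℝ ∞ fun r : ℝ => (2 * r)⁻¹ ^ k * expNegInvGlue (2 * r) := by
    have := (expNegInvGlue.contDiff_polynomial_eval_inv_mul (n := ⊤) (Polynomial.X ^ k)).comp
      (contDiff_const.mul contDiff_id : ContDiff ℝ _ fun r : ℝ => 2 * r)
    simpa only [Function.comp_def, Polynomial.eval_pow, Polynomial.eval_X] using this
  have h2 : ContDiff ℝ ∞ fun r : ℝ => (expNegInvGlue (2 * r) + expNegInvGlue (1 - 2 * r))⁻¹ := by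
    refine ContDiff.inv ?_ fun r => (Real.smoothTransition.pos_denom (2 * r)).ne'
    exact (expNegInvGlue.contDiff.comp (contDiff_const.mul contDiff_id)).add
      (expNegInvGlue.contDiff.comp (contDiff_const.sub (contDiff_const.mul contDiff_id)))
  refine (congrArg (ContDiff ℝ ∞) (funext fun r => ?_)).mpr
    ((contDiff_const (c := (2 : ℝ) ^ k)).mul (h1.mul h2))
  simp only [Real.smoothTransition, mul_inv, mul_pow, div_eq_mul_inv]
  have : (2 : ℝ) ^ k * 2⁻¹ ^ k = 1 := by rw [← mul_pow]; norm_num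
  linear_combination (r⁻¹ ^ k * expNegInvGlue (2 * r) *
    (expNegInvGlue (2 * r) + expNegInvGlue (1 - 2 * r))⁻¹) * (-this)

lemma rho_eq (r : ℝ) : rho r = 1 - Real.smoothTransition (2 * r) := by
  rw [rho]
  split_ifs with h1 h2
  · rw [Real.smoothTransition.zero_of_nonpos (by linarith), sub_zero]
  · have ha : ¬ 2 * r ≤ 0 := by linarith
    have hb : ¬ 1 - 2 * r ≤ 0 := by linarith
    have hb' : 2 * r - 1 ≠ 0 := by intro h; apply hb; linarith
    have hb2 : 1 - 2 * r ≠ 0 := by intro h; apply hb; linarith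
    have hr : r ≠ 0 := by intro h; apply h1; linarith
    have e1 : Real.exp (1 / (2 * r) + 1 / (2 * r - 1)) =
        Real.exp (-(1 - 2 * r)⁻¹) / Real.exp (-(2 * r)⁻¹) := by
      rw [← Real.exp_sub]
      congr 1
      rw [show 2 * r - 1 = -(1 - 2 * r) by ring, one_div, one_div, inv_neg]
      ring
    rw [Real.smoothTransition, expNegInvGlue, expNegInvGlue, if_neg ha, if_neg hb, e1]
    have p1 := Real.exp_pos (-(1 - 2 * r)⁻¹)
    have p2 := Real.exp_pos (-(2 * r)⁻¹)
    field_simp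
    ring
  · rw [Real.smoothTransition.one_of_one_le (by linarith), sub_self]

lemma rho_eq_zero {r : ℝ} (h : 1 / 2 ≤ r) : rho r = 0 := by
  rw [rho_eq, Real.smoothTransition.one_of_one_le (by linarith), sub_self]

lemma rho_zero : rho 0 = 1 := by simp [rho]

/-- `ρ(|s|)` is smooth at the origin too: it is a smooth function of `|s|²`. -/
lemma contDiff_rho_norm : ContDiff ℝ ∞ fun s : ℂ => (rho ‖s‖ : ℂ) := by
  have h := Complex.ofRealCLM.contDiff.comp ((contDiff_const (c := (1 : ℝ))).sub
    (flat_smoothTransition.contDiff_sqrt.comp (contDiff_norm_sq ℝ (E := ℂ))))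
  refine (congrArg (ContDiff ℝ ∞) (funext fun s => ?_)).mpr h
  simp [rho_eq]

/-- The quotient `(1 - ρ(|s|)) / s` is smooth at the origin too: it is `conj s` times a smooth
function of `|s|²`. -/
lemma contDiff_one_sub_rho_div : ContDiff ℝ ∞ fun s : ℂ => (1 - (rho ‖s‖ : ℂ)) / s := by
  have h := Complex.ofRealCLM.contDiff.comp
    ((flat_smoothTransition.inv_pow_mul 2).contDiff_sqrt.comp (contDiff_norm_sq ℝ (E := ℂ)))
  have h' : ContDiff ℝ ∞ _ := (Complex.conjCLE : ℂ →L[ℝ] ℂ).contDiff.mul h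
  refine (congrArg (ContDiff ℝ ∞) (funext fun s => ?_)).mpr h'
  rcases eq_or_ne s 0 with rfl | hs
  · simp
  · simp only [Function.comp_apply, Real.sqrt_sq (norm_nonneg s), rho_eq]
    simp only [ContinuousLinearEquiv.coe_coe, Complex.conjCLE_apply, Complex.ofRealCLM_apply]
    push_cast
    have h1 : (‖s‖ : ℂ) ≠ 0 := by simpa using hs
    have h2 : (starRingEnd ℂ) s * s = (‖s‖ : ℂ) ^ 2 := Complex.conj_mul' s
    field_simp
    linear_combination (-(Real.smoothTransition (2 * ‖s‖) : ℂ)) * h2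

/-! ### Fuchsian systems on a star-shaped domain -/

section Fuchs

open Set Metric MeasureTheory
open scoped Interval

variable {E : Type*} [NormedAddCommGroup E] [NormedSpace ℂ E]

lemma ofReal_mul_mem {D : Set ℂ} (hD : StarConvex ℝ 0 D) {z : ℂ} (hz : z ∈ D) {t : ℝ}
    (h0 : 0 ≤ t) (h1 : t ≤ 1) : (t : ℂ) * z ∈ D := by
  simpa using hD.smul_mem hz h0 h1

/-- The union of the segments from `0` to the points of a closed disc. -/
def cone (z : ℂ) (r : ℝ) : Set ℂ :=
  (fun p : ℝ × ℂ => (p.1 : ℂ) * p.2) '' (Icc 0 1 ×ˢ closedBall z r)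

lemma isCompact_cone (z : ℂ) (r : ℝ) : IsCompact (cone z r) :=
  (isCompact_Icc.prod (isCompact_closedBall z r)).image (by fun_prop)

lemma ofReal_mul_mem_cone {z w : ℂ} {r t : ℝ} (hw : w ∈ cone z r) (h0 : 0 ≤ t) (h1 : t ≤ 1) :
    (t : ℂ) * w ∈ cone z r := by
  obtain ⟨⟨s, v⟩, ⟨hs, hv⟩, rfl⟩ := hw
  refine ⟨(t * s, v), ⟨⟨mul_nonneg h0 hs.1, mul_le_one₀ h1 hs.1 hs.2⟩, hv⟩, ?_⟩
  push_cast
  ring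

lemma closedBall_subset_cone (z : ℂ) (r : ℝ) : closedBall z r ⊆ cone z r := fun w hw =>
  ⟨(1, w), ⟨⟨zero_le_one, le_rfl⟩, hw⟩, by simp⟩

lemma cone_subset {D : Set ℂ} (hD : StarConvex ℝ 0 D) {z : ℂ} {r : ℝ} (h : closedBall z r ⊆ D) :
    cone z r ⊆ D := by
  rintro _ ⟨⟨s, v⟩, ⟨hs, hv⟩, rfl⟩
  exact ofReal_mul_mem hD (h hv) hs.1 hs.2

/-- The weighted mean `∫₀¹ t ^ N • g (t z) dt`, which solves `z y' + (N + 1) y = g`. -/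
noncomputable def rayMean (N : ℕ) (g : ℂ → E) (z : ℂ) : E :=
  ∫ t in (0 : ℝ)..1, (t : ℂ) ^ N • g (t * z)

lemma continuousOn_ray {D : Set ℂ} (hD : StarConvex ℝ 0 D) {g : ℂ → E} (hg : ContinuousOn g D)
    {z : ℂ} (hz : z ∈ D) (N : ℕ) :
    ContinuousOn (fun t : ℝ => (t : ℂ) ^ N • g (t * z)) (Icc 0 1) := by
  refine ContinuousOn.smul (by fun_prop) (hg.comp (by fun_prop) fun t ht => ?_)
  exact ofReal_mul_mem hD hz ht.1 ht.2

lemma hasDerivAt_rayMean [CompleteSpace E] {D : Set ℂ} (hDo : IsOpen D) (hD : StarConvex ℝ 0 D)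
    {g : ℂ → E}
    (hg : DifferentiableOn ℂ g D) (N : ℕ) {z : ℂ} (hz : z ∈ D) :
    HasDerivAt (rayMean N g) (rayMean (N + 1) (deriv g) z) z := by
  obtain ⟨r, hr, hrD⟩ := nhds_basis_closedBall.mem_iff.1 (hDo.mem_nhds hz)
  have hK : cone z r ⊆ D := cone_subset hD hrD
  have hg' : DifferentiableOn ℂ (deriv g) D := hg.deriv hDo
  obtain ⟨C, hC⟩ := (isCompact_cone z r).exists_bound_of_continuousOn (hg'.continuousOn.mono hK)
  have hu : ∀ t ∈ Ι (0 : ℝ) 1, 0 ≤ t ∧ t ≤ 1 := fun t ht => by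
    rw [uIoc_of_le zero_le_one] at ht
    exact ⟨ht.1.le, ht.2⟩
  have hint : ∀ {h : ℂ → E} (_ : ContinuousOn h D) (M : ℕ) {w : ℂ} (_ : w ∈ D),
      IntervalIntegrable (fun t : ℝ => (t : ℂ) ^ M • h (t * w)) volume 0 1 := by
    intro h hh M w hw
    refine ContinuousOn.intervalIntegrable ?_
    rw [uIcc_of_le zero_le_one]
    exact continuousOn_ray hD hh hw M
  refine (intervalIntegral.hasDerivAt_integral_of_dominated_loc_of_deriv_le
    (F := fun (w : ℂ) (t : ℝ) => (t : ℂ) ^ N • g (t * w))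
    (F' := fun (w : ℂ) (t : ℝ) => (t : ℂ) ^ (N + 1) • deriv g (t * w))
    (bound := fun _ => C) (s := ball z r) (ball_mem_nhds z hr) ?_ (hint hg.continuousOn N hz)
    (hint hg'.continuousOn (N + 1) hz).aestronglyMeasurable_restrict_uIoc ?_
    intervalIntegrable_const ?_).2
  · filter_upwards [hDo.mem_nhds hz] with w hw
    exact (hint hg.continuousOn N hw).aestronglyMeasurable_restrict_uIoc
  · refine Eventually.of_forall fun t ht w hw => ?_
    obtain ⟨h0, h1⟩ := hu t ht
    rw [norm_smul, norm_pow, Complex.norm_real, Real.norm_of_nonneg h0]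
    have hb := hC _ (ofReal_mul_mem_cone (closedBall_subset_cone z r (ball_subset_closedBall hw))
      h0 h1)
    exact (mul_le_of_le_one_left (norm_nonneg _) (pow_le_one₀ h0 h1)).trans hb
  · refine Eventually.of_forall fun t ht w hw => ?_
    obtain ⟨h0, h1⟩ := hu t ht
    have hm := ofReal_mul_mem hD (hrD (ball_subset_closedBall hw)) h0 h1
    have h2 := (hg.differentiableAt (hDo.mem_nhds hm)).hasDerivAt.scomp w
      ((hasDerivAt_id w).const_mul (t : ℂ))
    refine (h2.const_smul ((t : ℂ) ^ N)).congr_deriv ?_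
    rw [mul_one, smul_smul, pow_succ]

lemma rayMean_ode [CompleteSpace E] {D : Set ℂ} (hDo : IsOpen D) (hD : StarConvex ℝ 0 D)
    {g : ℂ → E}
    (hg : DifferentiableOn ℂ g D) (N : ℕ) {z : ℂ} (hz : z ∈ D) :
    z • deriv (rayMean N g) z + ((N : ℂ) + 1) • rayMean N g z = g z := by
  rw [(hasDerivAt_rayMean hDo hD hg N hz).deriv]
  have hg' : DifferentiableOn ℂ (deriv g) D := hg.deriv hDo
  have hint : ∀ {h : ℂ → E} (_ : ContinuousOn h D) (M : ℕ),
      IntervalIntegrable (fun t : ℝ => (t : ℂ) ^ M • h (t * z)) volume 0 1 := by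
    intro h hh M
    refine ContinuousOn.intervalIntegrable ?_
    rw [uIcc_of_le zero_le_one]
    exact continuousOn_ray hD hh hz M
  rw [rayMean, rayMean, ← intervalIntegral.integral_smul, ← intervalIntegral.integral_smul,
    ← intervalIntegral.integral_add
      (f := fun t : ℝ => z • (t : ℂ) ^ (N + 1) • deriv g (t * z))
      (g := fun t : ℝ => ((N : ℂ) + 1) • (t : ℂ) ^ N • g (t * z))
      ((hint hg'.continuousOn _).smul z) ((hint hg.continuousOn _).smul _)]
  rw [intervalIntegral.integral_eq_sub_of_hasDerivAt
    (f := fun t : ℝ => (t : ℂ) ^ (N + 1) • g (t * z))]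
  · simp
  · intro t ht
    rw [uIcc_of_le zero_le_one] at ht
    have hm := ofReal_mul_mem hD hz ht.1 ht.2
    have h1 : HasDerivAt (fun s : ℝ => (s : ℂ) * z) z t := by
      simpa using (Complex.ofRealCLM.hasDerivAt (x := t)).mul_const z
    have h2 := (hg.differentiableAt (hDo.mem_nhds hm)).hasDerivAt.scomp t h1
    have h3 : HasDerivAt (fun s : ℝ => (s : ℂ) ^ (N + 1)) (((N : ℂ) + 1) * (t : ℂ) ^ N) t := by
      have h := (hasDerivAt_id t).ofReal_comp.pow (N + 1)
      simp only [Pi.pow_def, id_eq, Complex.ofReal_one, mul_one, Nat.add_sub_cancel,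
        Nat.cast_add, Nat.cast_one] at h
      exact h
    refine (h3.smul h2).congr_deriv ?_
    simp only [Function.comp_apply, smul_smul]
    rw [mul_comm z]
  · exact ((hint hg'.continuousOn _).smul z).add ((hint hg.continuousOn _).smul _)

/-- The estimate that makes the Neumann series converge. If `|X w| ≤ C exp (l |w|)` and
`|B w| ≤ b + M |w|`, then `g = B X` satisfies the hypothesis, and the constant `C` is halved by
`rayMean N` when `b ≤ (N + 1) / 2` and `M ≤ l / 2`. -/
lemma norm_rayMean_le {g : ℂ → E} {N : ℕ} {b M C l : ℝ} (hC : 0 ≤ C) (hb : 2 * b ≤ N + 1)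
    (hM : 2 * M ≤ l) {w : ℂ}
    (h : ∀ t : ℝ, 0 ≤ t → t ≤ 1 →
      ‖g (t * w)‖ ≤ (b + M * (t * ‖w‖)) * (C * Real.exp (l * (t * ‖w‖)))) :
    ‖rayMean N g w‖ ≤ C / 2 * Real.exp (l * ‖w‖) := by
  -- the integrand is dominated by the derivative of `C / 2 * t ^ (N + 1) * exp (l t |w|)`
  set φ : ℝ → ℝ := fun t => C / 2 * ((((N + 1 : ℕ) : ℝ) * t ^ N) * Real.exp (l * (t * ‖w‖))
    + t ^ (N + 1) * (Real.exp (l * (t * ‖w‖)) * (l * ‖w‖))) with hφ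
  have hφc : Continuous φ := by fun_prop
  have h1 : ‖rayMean N g w‖ ≤ ∫ t in (0 : ℝ)..1, φ t := by
    refine intervalIntegral.norm_integral_le_of_norm_le zero_le_one
      (Eventually.of_forall fun t ht => ?_) (hφc.intervalIntegrable _ _)
    have h0 : 0 ≤ t := ht.1.le
    rw [norm_smul, norm_pow, Complex.norm_real, Real.norm_of_nonneg h0]
    refine (mul_le_mul_of_nonneg_left (h t h0 ht.2) (pow_nonneg h0 N)).trans ?_
    have e : φ t - t ^ N * ((b + M * (t * ‖w‖)) * (C * Real.exp (l * (t * ‖w‖)))) =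
        (C * t ^ N * Real.exp (l * (t * ‖w‖)) / 2) *
          ((N + 1 - 2 * b) + (l - 2 * M) * (t * ‖w‖)) := by
      simp only [hφ]
      push_cast
      ring
    have : 0 ≤ φ t - t ^ N * ((b + M * (t * ‖w‖)) * (C * Real.exp (l * (t * ‖w‖)))) := by
      rw [e]
      have h3 : 0 ≤ N + 1 - 2 * b := by linarith
      have h4 : 0 ≤ l - 2 * M := by linarith
      positivity
    linarith
  have h2 : ∫ t in (0 : ℝ)..1, φ t = C / 2 * Real.exp (l * ‖w‖) := by
    rw [intervalIntegral.integral_eq_sub_of_hasDerivAt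
      (f := fun t : ℝ => C / 2 * (t ^ (N + 1) * Real.exp (l * (t * ‖w‖))))]
    · simp
    · intro t _
      have ha : HasDerivAt (fun s : ℝ => l * (s * ‖w‖)) (l * ‖w‖) t := by
        simpa using ((hasDerivAt_id t).mul_const ‖w‖).const_mul l
      refine (((hasDerivAt_pow (N + 1) t).mul ha.exp).const_mul (C / 2)).congr_deriv ?_
      simp [hφ]
    · exact hφc.intervalIntegrable _ _
  exact h1.trans h2.le

/-- The iterates `X₀ = J R`, `X_{k+1} = J (A₀ X_k + z A₁ X_k)` of the integral equation, where `J`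
is the operator `rayMean N`. -/
noncomputable def fuchsIter (N : ℕ) (A₀ : E →L[ℂ] E) (A₁ : ℂ → E →L[ℂ] E) (R : ℂ → E) :
    ℕ → ℂ → E
  | 0 => rayMean N R
  | k + 1 => rayMean N fun z => (A₀ + z • A₁ z) (fuchsIter N A₀ A₁ R k z)

/-- If `|A₀|` is small compared with `N`, then the Fuchsian system
`z Y' + (N + 1) Y = (A₀ + z A₁(z)) Y + R(z)` has an analytic solution on all of a star-shaped
domain: the Neumann series of the equivalent integral equation. -/
theorem exists_fuchs_solution [CompleteSpace E] {D : Set ℂ} (hDo : IsOpen D)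
    (hD : StarConvex ℝ 0 D) (N : ℕ)
    (A₀ : E →L[ℂ] E) (hA₀ : 2 * ‖A₀‖ ≤ N + 1) {A₁ : ℂ → E →L[ℂ] E}
    (hA₁ : DifferentiableOn ℂ A₁ D) {R : ℂ → E} (hR : DifferentiableOn ℂ R D) :
    ∃ Y : ℂ → E, DifferentiableOn ℂ Y D ∧ ∀ z ∈ D,
      z • deriv Y z + ((N : ℂ) + 1) • Y z = (A₀ + z • A₁ z) (Y z) + R z := by
  set X := fuchsIter N A₀ A₁ R with hX
  set B : ℂ → E →L[ℂ] E := fun z => A₀ + z • A₁ z with hB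
  have hBd : DifferentiableOn ℂ B D :=
    (differentiableOn_const A₀).add (differentiableOn_id.smul hA₁)
  have hJ : ∀ {g : ℂ → E}, DifferentiableOn ℂ g D → DifferentiableOn ℂ (rayMean N g) D :=
    fun hg z hz => (hasDerivAt_rayMean hDo hD hg N hz).differentiableAt.differentiableWithinAt
  have hXd : ∀ k, DifferentiableOn ℂ (X k) D := by
    intro k
    induction k with
    | zero => exact hJ hR
    | succ k ih => exact hJ (hBd.clm_apply ih)
  have hode0 : ∀ z ∈ D, z • deriv (X 0) z + ((N : ℂ) + 1) • X 0 z = R z := fun z hz =>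
    rayMean_ode hDo hD hR N hz
  have hode : ∀ k, ∀ z ∈ D, z • deriv (X (k + 1)) z + ((N : ℂ) + 1) • X (k + 1) z = B z (X k z) :=
    fun k z hz => rayMean_ode hDo hD (hBd.clm_apply (hXd k)) N hz
  have hloc : ∀ z ∈ D, ∃ u : ℕ → ℝ, Summable u ∧ ∃ r > 0, ball z r ⊆ D ∧
      ∀ k, ∀ w ∈ ball z r, ‖X k w‖ ≤ u k := by
    intro z hz
    obtain ⟨r, hr, hrD⟩ := nhds_basis_closedBall.mem_iff.1 (hDo.mem_nhds hz)
    have hK : cone z r ⊆ D := cone_subset hD hrD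
    obtain ⟨M, hM⟩ := (isCompact_cone z r).exists_bound_of_continuousOn (hA₁.continuousOn.mono hK)
    obtain ⟨C, hC⟩ := (isCompact_cone z r).exists_bound_of_continuousOn
      ((hXd 0).continuousOn.mono hK)
    have hzK : z ∈ cone z r := closedBall_subset_cone z r (mem_closedBall_self hr.le)
    have hM0 : 0 ≤ M := (norm_nonneg _).trans (hM z hzK)
    have hC0 : 0 ≤ C := (norm_nonneg _).trans (hC z hzK)
    obtain ⟨L, hL⟩ := (isCompact_cone z r).exists_bound_of_continuousOn
      (f := fun w : ℂ => w) continuousOn_id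
    have hbd : ∀ k, ∀ w ∈ cone z r, ‖X k w‖ ≤ C * (1 / 2) ^ k * Real.exp (2 * M * ‖w‖) := by
      intro k
      induction k with
      | zero =>
        intro w hw
        rw [pow_zero, mul_one]
        exact (hC w hw).trans (le_mul_of_one_le_right hC0 (Real.one_le_exp (by positivity)))
      | succ k ih =>
        intro w hw
        have := norm_rayMean_le (g := fun z => B z (X k z)) (N := N) (b := ‖A₀‖) (M := M)
          (C := C * (1 / 2) ^ k) (l := 2 * M) (w := w) (by positivity) hA₀ le_rfl ?_
        · refine this.trans (le_of_eq ?_)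
          rw [pow_succ]
          ring
        · intro t h0 h1
          have hm := ofReal_mul_mem_cone hw h0 h1
          have hn : ‖(t : ℂ) * w‖ = t * ‖w‖ := by
            rw [norm_mul, Complex.norm_real, Real.norm_of_nonneg h0]
          refine ((B _).le_opNorm _).trans ?_
          have h2 := ih _ hm
          rw [hn] at h2
          refine mul_le_mul ?_ h2 (norm_nonneg _) (by positivity)
          refine (norm_add_le _ _).trans ?_
          rw [norm_smul, hn]
          have h5 := mul_le_mul_of_nonneg_left (hM _ hm) (mul_nonneg h0 (norm_nonneg w))
          linarith
    refine ⟨fun k => C * (1 / 2) ^ k * Real.exp (2 * M * L), ?_, r, hr,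
      ball_subset_closedBall.trans hrD, fun k w hw => ?_⟩
    · exact (summable_geometric_two.mul_left C).mul_right _
    · have hwK := closedBall_subset_cone z r (ball_subset_closedBall hw)
      refine (hbd k w hwK).trans (mul_le_mul_of_nonneg_left (Real.exp_le_exp.2 ?_) (by positivity))
      exact mul_le_mul_of_nonneg_left (hL w hwK) (by positivity)
  refine ⟨fun z => ∑' k, X k z, fun z hz => ?_, fun z hz => ?_⟩
  · obtain ⟨u, hu, r, hr, hrD, hb⟩ := hloc z hz
    have := Complex.differentiableOn_tsum_of_summable_norm hu (fun k => (hXd k).mono hrD)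
      isOpen_ball hb
    exact (this.differentiableAt (ball_mem_nhds z hr)).differentiableWithinAt
  · obtain ⟨u, hu, r, hr, hrD, hb⟩ := hloc z hz
    have hzr := mem_ball_self hr (x := z)
    have h1 := Complex.hasSum_deriv_of_summable_norm hu (fun k => (hXd k).mono hrD)
      isOpen_ball hb hzr
    have h2 : HasSum (fun k => X k z) (∑' k, X k z) :=
      (Summable.of_norm_bounded hu fun k => hb k z hzr).hasSum
    have h3 := (h1.const_smul z).add (h2.const_smul ((N : ℂ) + 1))
    rw [← hasSum_nat_add_iff' 1] at h3
    simp only [Finset.range_one, Finset.sum_singleton, hode0 z hz, hode _ z hz] at h3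
    have h4 := (B z).hasSum h2
    rw [← h3.unique h4, sub_add_cancel]

end Fuchs

/-! ### Power series expansions at the origin -/

section Series

variable {E : Type*} [NormedAddCommGroup E] [NormedSpace ℂ E]

/-- `f` is the sum of the power series with coefficients `c` near `0`. -/
def HasSer (f : ℂ → E) (c : ℕ → E) : Prop :=
  ∀ᶠ z in 𝓝 (0 : ℂ), HasSum (fun n => z ^ n • c n) (f z)

lemma HasSer.congr {f g : ℂ → E} {c : ℕ → E} (h : HasSer f c) (hfg : f =ᶠ[𝓝 0] g) :
    HasSer g c := by
  filter_upwards [h, hfg] with z hz e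
  rwa [← e]

lemma HasSer.congr_coeff {f : ℂ → E} {c d : ℕ → E} (h : HasSer f c) (hcd : ∀ n, c n = d n) :
    HasSer f d := by
  rwa [← funext hcd]

lemma HasSer.add {f g : ℂ → E} {c d : ℕ → E} (hf : HasSer f c) (hg : HasSer g d) :
    HasSer (fun z => f z + g z) (fun n => c n + d n) := by
  filter_upwards [hf, hg] with z h1 h2
  simpa only [smul_add] using HasSum.add h1 h2

lemma HasSer.sub {f g : ℂ → E} {c d : ℕ → E} (hf : HasSer f c) (hg : HasSer g d) :
    HasSer (fun z => f z - g z) (fun n => c n - d n) := by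
  filter_upwards [hf, hg] with z h1 h2
  simpa only [smul_sub] using HasSum.sub h1 h2

lemma HasSer.map {F : Type*} [NormedAddCommGroup F] [NormedSpace ℂ F] {f : ℂ → E} {c : ℕ → E}
    (hf : HasSer f c) (L : E →L[ℂ] F) : HasSer (fun z => L (f z)) (fun n => L (c n)) := by
  filter_upwards [hf] with z h
  simpa only [map_smul] using L.hasSum h

lemma HasSer.const_smul {f : ℂ → E} {c : ℕ → E} (hf : HasSer f c) (k : ℂ) :
    HasSer (fun z => k • f z) (fun n => k • c n) :=
  hf.map (k • ContinuousLinearMap.id ℂ E)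

lemma HasSer.const_mul {A : Type*} [NormedRing A] [NormedAlgebra ℂ A] {f : ℂ → A} {c : ℕ → A}
    (hf : HasSer f c) (k : A) : HasSer (fun z => k * f z) (fun n => k * c n) :=
  hf.map (ContinuousLinearMap.mul ℂ A k)

lemma hasSer_zero : HasSer (fun _ => (0 : E)) (fun _ => 0) :=
  Eventually.of_forall fun z => by simp

/-- The coefficient sequence of `z f(z)`. -/
def shift (c : ℕ → E) : ℕ → E
  | 0 => 0
  | n + 1 => c n

lemma HasSer.smul_id {f : ℂ → E} {c : ℕ → E} (hf : HasSer f c) :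
    HasSer (fun z => z • f z) (shift c) := by
  filter_upwards [hf] with z h
  rw [← hasSum_nat_add_iff' 1]
  simpa [shift, pow_succ', smul_smul] using h.const_smul z

/-- The formal multilinear series with coefficients `c`. -/
noncomputable def toFMS (c : ℕ → E) : FormalMultilinearSeries ℂ ℂ E := fun n =>
  ContinuousMultilinearMap.mkPiRing ℂ (Fin n) (c n)

lemma coeff_toFMS (c : ℕ → E) (n : ℕ) : (toFMS c).coeff n = c n := by
  simp [FormalMultilinearSeries.coeff, toFMS]

lemma hasSer_iff {f : ℂ → E} {c : ℕ → E} : HasSer f c ↔ HasFPowerSeriesAt f (toFMS c) 0 := by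
  simp only [hasFPowerSeriesAt_iff, coeff_toFMS, zero_add, HasSer]

lemma HasSer.analyticAt {f : ℂ → E} {c : ℕ → E} (h : HasSer f c) : AnalyticAt ℂ f 0 :=
  (hasSer_iff.1 h).analyticAt

lemma exists_hasSer {f : ℂ → E} (h : AnalyticAt ℂ f 0) : ∃ c, HasSer f c := by
  obtain ⟨p, hp⟩ := h
  refine ⟨p.coeff, ?_⟩
  simpa only [hasFPowerSeriesAt_iff, zero_add, HasSer] using hp

lemma HasSer.unique {f : ℂ → E} {c d : ℕ → E} (hc : HasSer f c) (hd : HasSer f d) (n : ℕ) :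
    c n = d n := by
  have := (hasSer_iff.1 hc).eq_formalMultilinearSeries (hasSer_iff.1 hd)
  rw [← coeff_toFMS c, this, coeff_toFMS]

lemma HasSer.eventuallyEq {f g : ℂ → E} {c : ℕ → E} (hf : HasSer f c) (hg : HasSer g c) :
    f =ᶠ[𝓝 0] g := by
  filter_upwards [hf, hg] with z h1 h2 using HasSum.unique h1 h2

lemma HasSer.theta [CompleteSpace E] {f : ℂ → E} {c : ℕ → E} (h : HasSer f c) :
    HasSer (fun z => z • deriv f z) (fun n => (n : ℂ) • c n) := by
  obtain ⟨r, hr⟩ := hasSer_iff.1 h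
  have h1 : HasFPowerSeriesAt (fderiv ℂ f) (toFMS c).derivSeries 0 := hr.fderiv.hasFPowerSeriesAt
  have h2 : HasSer (deriv f) (fun n => ((n : ℂ) + 1) • c (n + 1)) := by
    rw [hasFPowerSeriesAt_iff] at h1
    filter_upwards [h1] with z hz
    have h3 := (ContinuousLinearMap.apply ℂ E (1 : ℂ)).hasSum hz
    simp only [map_smul, ContinuousLinearMap.apply_apply, zero_add, fderiv_apply_one_eq_deriv,
      FormalMultilinearSeries.derivSeries_coeff_one, coeff_toFMS] at h3
    refine h3.congr_fun fun n => ?_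
    rw [← Nat.cast_smul_eq_nsmul ℂ]
    push_cast
    rfl
  refine h2.smul_id.congr_coeff fun n => ?_
  rcases n with _ | n <;> simp [shift]

/-- Prepending finitely many coefficients to a power series. -/
lemma HasSer.of_tail {f : ℂ → E} {c : ℕ → E} (N : ℕ) (h : HasSer f fun n => c (n + N)) :
    HasSer (fun z => ∑ n ∈ Finset.range N, z ^ n • c n + z ^ N • f z) c := by
  filter_upwards [h] with z hz
  rw [← hasSum_nat_add_iff' N, add_sub_cancel_left]
  refine (hz.const_smul (z ^ N)).congr_fun fun n => ?_
  rw [smul_smul, ← pow_add, add_comm]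

end Series

/-! ### The star domain -/

lemma sub_one_ne_zero_of_mem {a z : ℂ} (hz : z ∈ starDomain a) : z - 1 ≠ 0 := by
  have := (hz 1 le_rfl).1
  rw [Complex.ofReal_one] at this
  exact sub_ne_zero.2 this

lemma sub_ne_zero_of_mem {a z : ℂ} (hz : z ∈ starDomain a) : z - a ≠ 0 := by
  have := (hz 1 le_rfl).2
  rw [Complex.ofReal_one, one_mul] at this
  exact sub_ne_zero.2 this

lemma zero_mem_starDomain {a : ℂ} (ha : a ≠ 0) : (0 : ℂ) ∈ starDomain a := by
  intro t ht
  have : (t : ℂ) ≠ 0 := by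
    rw [Complex.ofReal_ne_zero]
    linarith
  exact ⟨this.symm, (mul_ne_zero this ha).symm⟩

lemma starConvex_starDomain {a : ℂ} (ha : a ≠ 0) : StarConvex ℝ 0 (starDomain a) := by
  rw [starConvex_zero_iff]
  intro z hz s h0 h1 t ht
  rcases h0.eq_or_lt with rfl | h0
  · simpa using zero_mem_starDomain ha t ht
  have hs : (s : ℂ) ≠ 0 := by exact_mod_cast h0.ne'
  have hts : 1 ≤ t / s := by rw [one_le_div h0]; linarith
  have := hz (t / s) hts
  push_cast at this
  rw [Complex.real_smul]
  refine ⟨fun h => this.1 ?_, fun h => this.2 ?_⟩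
  · rw [← h]; field_simp
  · rw [div_mul_eq_mul_div, ← h]; field_simp

lemma isOpen_starDomain {a : ℂ} (ha : a ≠ 0) : IsOpen (starDomain a) := by
  have h1 : IsClosed ((fun t : ℝ => (t : ℂ)) '' Set.Ici 1) :=
    Complex.isometry_ofReal.isClosedEmbedding.isClosedMap _ isClosed_Ici
  have h2 : IsClosed ((fun z : ℂ => z * a) '' ((fun t : ℝ => (t : ℂ)) '' Set.Ici 1)) :=
    (Homeomorph.mulRight₀ a ha).isClosedMap _ h1
  have : starDomain a = ((fun t : ℝ => (t : ℂ)) '' Set.Ici 1)ᶜ ∩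
      ((fun z : ℂ => z * a) '' ((fun t : ℝ => (t : ℂ)) '' Set.Ici 1))ᶜ := by
    ext z
    simp only [starDomain, Set.mem_ofPred_eq, Set.mem_inter_iff, Set.mem_compl_iff, Set.mem_image,
      Set.mem_Ici]
    constructor
    · intro h
      refine ⟨?_, ?_⟩
      · rintro ⟨t, ht, rfl⟩
        exact (h t ht).1 rfl
      · rintro ⟨_, ⟨t, ht, rfl⟩, rfl⟩
        exact (h t ht).2 rfl
    · rintro ⟨h, h'⟩ t ht
      exact ⟨fun e => h ⟨t, ht, e.symm⟩, fun e => h' ⟨t, ⟨t, ht, rfl⟩, e.symm⟩⟩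
  rw [this]
  exact h1.isOpen_compl.inter h2.isOpen_compl

lemma isPreconnected_starDomain {a : ℂ} (ha : a ≠ 0) : IsPreconnected (starDomain a) :=
  ((starConvex_starDomain ha).isPathConnected (zero_mem_starDomain ha)).isConnected.isPreconnected

/-- Identity theorem on the star domain. -/
lemma eqOn_starDomain {E : Type*} [NormedAddCommGroup E] [NormedSpace ℂ E]
    {a : ℂ} (ha : a ≠ 0) {f g : ℂ → E} (hf : AnalyticOnNhd ℂ f (starDomain a))
    (hg : AnalyticOnNhd ℂ g (starDomain a)) (h : f =ᶠ[𝓝 0] g) : Set.EqOn f g (starDomain a) :=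
  hf.eqOn_of_preconnected_of_eventuallyEq hg (isPreconnected_starDomain ha)
    (zero_mem_starDomain ha) h

lemma isContinuation_iff {a : ℂ} {c : ℕ → ℂ} {f : ℂ → ℂ} :
    IsContinuation a c f ↔ AnalyticOnNhd ℂ f (starDomain a) ∧ HasSer f c := by
  simp only [IsContinuation, HasSer, smul_eq_mul, mul_comm]

lemma IsContinuation.eqOn {a : ℂ} (ha : a ≠ 0) {c : ℕ → ℂ} {f g : ℂ → ℂ}
    (hf : IsContinuation a c f) (hg : IsContinuation a c g) : Set.EqOn f g (starDomain a) := by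
  rw [isContinuation_iff] at hf hg
  exact eqOn_starDomain ha hf.1 hg.1 (hf.2.eventuallyEq hg.2)

lemma isContinuation_continuation {a : ℂ} {c : ℕ → ℂ} {f : ℂ → ℂ}
    (hf : IsContinuation a c f) : IsContinuation a c (continuation a c) := by
  have h : ∃ f, IsContinuation a c f := ⟨f, hf⟩
  rw [continuation, dif_pos h]
  exact h.choose_spec

lemma IsContinuation.continuation_eq {a : ℂ} (ha : a ≠ 0) {c : ℕ → ℂ} {f : ℂ → ℂ}
    (hf : IsContinuation a c f) {z : ℂ} (hz : z ∈ starDomain a) : continuation a c z = f z :=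
  (isContinuation_continuation hf).eqOn ha hf hz

/-! ### Heun series with coefficients in a commutative Banach algebra -/

section Algebra

variable {A : Type*} [NormedCommRing A] [NormedAlgebra ℂ A]

/-- `pA a γ k` is the coefficient `P n` with parameters in an algebra, for a complex
index. -/
def pA (a : ℂ) (γ : A) (k : ℂ) : A := (a * k) • (γ + (k - 1) • (1 : A))

/-- `qA a q γ δ ε k` is the coefficient `Q (k + 1)` with parameters in an algebra, for a complex
index. -/
def qA (a : ℂ) (q γ δ ε : A) (k : ℂ) : A :=
  q + k • ((a + 1) • (γ + (k - 1) • (1 : A)) + ε + a • δ)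

/-- `rA α β k` is the coefficient `R (k + 2)` with parameters in an algebra, for a complex index. -/
def rA (α β : A) (k : ℂ) : A := -((k • (1 : A) + α) * (k • (1 : A) + β))

/-- `pA a γ k` may be cancelled as soon as `k` exceeds the norm of `γ - 1`. -/
lemma pA_mul_cancel {a : ℂ} (ha : a ≠ 0) {γ : A} {k : ℕ} (hk : ‖γ - 1‖ < k) {u v : A}
    (h : pA a γ k * u = pA a γ k * v) : u = v := by
  have hk0 : (0 : ℝ) < k := (norm_nonneg _).trans_lt hk
  have hk' : (k : ℂ) ≠ 0 := by exact_mod_cast hk0.ne'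
  have h1 : (a * (k : ℂ)) • ((γ - 1) * (u - v) + (k : ℂ) • (u - v)) = 0 := by
    have h2 := sub_eq_zero.2 h
    rw [pA] at h2
    rw [← h2, smul_mul_assoc, smul_mul_assoc, ← smul_sub]
    congr 1
    simp only [Algebra.smul_def, map_sub, map_one]
    ring
  have h2 := (smul_eq_zero.1 h1).resolve_left (mul_ne_zero ha hk')
  have h3 : (k : ℂ) • (u - v) = -((γ - 1) * (u - v)) := by
    rw [eq_neg_iff_add_eq_zero, add_comm]; exact h2
  have h4 : (k : ℝ) * ‖u - v‖ ≤ ‖γ - 1‖ * ‖u - v‖ := by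
    have := congrArg norm h3
    rw [norm_smul, norm_neg, Complex.norm_natCast] at this
    rw [this]
    exact norm_mul_le _ _
  have h5 : ‖u - v‖ = 0 := by
    by_contra hne
    have : 0 < ‖u - v‖ := lt_of_le_of_ne (norm_nonneg _) (Ne.symm hne)
    exact absurd (le_of_mul_le_mul_right h4 this) (not_le.2 hk)
  exact sub_eq_zero.1 (norm_eq_zero.1 h5)

/-- The Euler form of the recurrence `P c = Q c + R c`: if `y₀`, `y₁`, `y₂` are the series of
`c n`, `(n + ν) c n`, `(n + ν)² c n`, the combination below has the three-term defects as
coefficients. -/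
lemma hasSer_euler {a ν : ℂ} {q α β γ δ ε : A} (hε : α + β + 1 = γ + δ + ε)
    {y₀ y₁ y₂ : ℂ → A} {c : ℕ → A} (h₀ : HasSer y₀ c)
    (h₁ : HasSer y₁ fun n => (n + ν) • c n)
    (h₂ : HasSer y₂ fun n => (n + ν) • (n + ν) • c n) :
    HasSer (fun z => ((z - 1) * (z - a)) • y₂ z
        + (((z - 1) * (z - a)) • (γ - 1) + (z * (z - a)) • δ + (z * (z - 1)) • ε) * y₁ z
        + z • ((z • (α * β) - q) * y₀ z))
      (fun n => pA a γ (n + ν) * c n - shift (fun m => qA a q γ δ ε (m + ν) * c m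
          + shift (fun l => rA α β (l + ν) * c l) m) n) := by
  have g0 := (h₂.const_smul a).add (h₁.const_mul (a • (γ - 1)))
  have g1 := ((h₂.const_smul (a + 1)).add (h₁.const_mul ((a + 1) • (γ - 1) + a • δ + ε))).add
    (h₀.const_mul q)
  have g2 := (h₂.add (h₁.const_mul (α + β))).add (h₀.const_mul (α * β))
  have g3 := g0.sub ((g1.sub g2.smul_id).smul_id)
  have hγ : γ = α + β + 1 - δ - ε := by rw [hε]; ring
  refine (g3.congr (Eventually.of_forall fun z => ?_)).congr_coeff fun n => ?_
  · subst hγ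
    simp only [Algebra.smul_def, map_mul, map_sub, map_add, map_one]
    ring
  · subst hγ
    rcases n with _ | _ | n <;>
    · simp only [shift, pA, qA, rA, Algebra.smul_def, map_mul, map_sub, map_add, map_one]
      ring

variable [CompleteSpace A]

/-- The Fuchsian system satisfied by the tail of a Heun series has an analytic solution on the star
domain, and comparing coefficients shows that this solution is the tail. -/
lemma exists_tail_continuation {a : ℂ} (ha : a ≠ 0) {q α β γ δ ε : A}
    (hε : α + β + 1 = γ + δ + ε) {N : ℕ} {x : ℕ → A}
    (hx : ∀ n : ℕ, pA a γ (n + 2 + (N + 1)) * x (n + 2) =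
      qA a q γ δ ε (n + 1 + (N + 1)) * x (n + 1) + rA α β (n + (N + 1)) * x n)
    (hN : ‖γ - 1‖ < N + 1)
    (hN' : 2 * ‖(ContinuousLinearMap.snd ℂ A A).prod
      ((ContinuousLinearMap.mul ℂ A (1 - γ)) ∘L (ContinuousLinearMap.snd ℂ A A))‖ ≤ N + 1) :
    ∃ G : ℂ → A, DifferentiableOn ℂ G (starDomain a) ∧ HasSer G x := by
  set D := starDomain a with hD
  have hDo : IsOpen D := isOpen_starDomain ha
  -- the unknown is the pair of the tail and its image under `N + 1 + z d/dz`
  set A₀ := (ContinuousLinearMap.snd ℂ A A).prod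
      ((ContinuousLinearMap.mul ℂ A (1 - γ)) ∘L (ContinuousLinearMap.snd ℂ A A)) with hA₀
  let m₁ : A → (A × A →L[ℂ] A × A) := fun k =>
    ContinuousLinearMap.inr ℂ A A ∘L ContinuousLinearMap.mul ℂ A k ∘L ContinuousLinearMap.fst ℂ A A
  let m₂ : A → (A × A →L[ℂ] A × A) := fun k =>
    ContinuousLinearMap.inr ℂ A A ∘L ContinuousLinearMap.mul ℂ A k ∘L ContinuousLinearMap.snd ℂ A A
  set A₁ : ℂ → (A × A →L[ℂ] A × A) := fun z => -((z - 1)⁻¹ • m₂ δ + (z - a)⁻¹ • m₂ ε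
    + ((z - 1)⁻¹ * (z - a)⁻¹ * z) • m₁ (α * β) - ((z - 1)⁻¹ * (z - a)⁻¹) • m₁ q) with hA₁
  -- the recurrence need not hold for the first two terms; the defects form the inhomogeneity
  set ρ₀ : A := pA a γ (N + 1) * x 0 with hρ₀
  set ρ₁ : A := pA a γ (1 + (N + 1)) * x 1 - qA a q γ δ ε (N + 1) * x 0 with hρ₁
  set R : ℂ → A × A := fun z => (0, ((z - 1)⁻¹ * (z - a)⁻¹) • (ρ₀ + z • ρ₁)) with hR
  have hi1 : DifferentiableOn ℂ (fun z : ℂ => (z - 1)⁻¹) D :=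
    DifferentiableOn.inv (by fun_prop) fun z hz => sub_one_ne_zero_of_mem hz
  have hi2 : DifferentiableOn ℂ (fun z : ℂ => (z - a)⁻¹) D :=
    DifferentiableOn.inv (by fun_prop) fun z hz => sub_ne_zero_of_mem hz
  obtain ⟨Y, hYd, hY⟩ := exists_fuchs_solution hDo (starConvex_starDomain ha) N A₀ hN'
    (A₁ := A₁) (R := R) (by fun_prop) (by fun_prop)
  have hY1 : ∀ z ∈ D, z • deriv (fun w => (Y w).1) z + ((N : ℂ) + 1) • (Y z).1 = (Y z).2 := by
    intro z hz
    have hd := (hYd.differentiableAt (hDo.mem_nhds hz)).hasDerivAt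
    have h1 := congrArg Prod.fst (hY z hz)
    have hder : deriv (fun w => (Y w).1) z = (deriv Y z).1 :=
      ((ContinuousLinearMap.fst ℂ A A).hasFDerivAt.comp_hasDerivAt z hd).deriv
    rw [hder]
    simpa [hA₀, hA₁, hR, m₁, m₂] using h1
  have hY2 : ∀ z ∈ D, ((z - 1) * (z - a)) •
      (z • deriv (fun w => (Y w).2) z + ((N : ℂ) + 1) • (Y z).2)
        + (((z - 1) * (z - a)) • (γ - 1) + (z * (z - a)) • δ + (z * (z - 1)) • ε) * (Y z).2
        + z • ((z • (α * β) - q) * (Y z).1) = ρ₀ + z • ρ₁ := by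
    intro z hz
    have hd := (hYd.differentiableAt (hDo.mem_nhds hz)).hasDerivAt
    have h1 := congrArg Prod.snd (hY z hz)
    have z1 := sub_one_ne_zero_of_mem hz
    have za := sub_ne_zero_of_mem hz
    have hder : deriv (fun w => (Y w).2) z = (deriv Y z).2 :=
      ((ContinuousLinearMap.snd ℂ A A).hasFDerivAt.comp_hasDerivAt z hd).deriv
    rw [hder]
    simp [hA₀, hA₁, hR, m₁, m₂] at h1
    rw [h1]
    have e1 : algebraMap ℂ A (z - 1) * algebraMap ℂ A (z - 1)⁻¹ = 1 := by
      rw [← map_mul, mul_inv_cancel₀ z1, map_one]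
    have e2 : algebraMap ℂ A (z - a) * algebraMap ℂ A (z - a)⁻¹ = 1 := by
      rw [← map_mul, mul_inv_cancel₀ za, map_one]
    simp only [Algebra.smul_def, map_mul]
    generalize algebraMap ℂ A (z - 1) = u at *
    generalize algebraMap ℂ A (z - a) = v at *
    generalize algebraMap ℂ A (z - 1)⁻¹ = u' at *
    generalize algebraMap ℂ A (z - a)⁻¹ = v' at *
    generalize algebraMap ℂ A z = w at *
    linear_combination (-w * v * δ * (Y z).2 + v * v' *
      (ρ₀ + w * ρ₁ - w * (w * (α * β) - q) * (Y z).1)) * e1 + (-w * u * ε * (Y z).2 +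
      (ρ₀ + w * ρ₁ - w * (w * (α * β) - q) * (Y z).1)) * e2
  have han : ∀ {f : ℂ → A}, DifferentiableOn ℂ f D → AnalyticAt ℂ f 0 := fun hf =>
    hf.analyticAt (hDo.mem_nhds (zero_mem_starDomain ha))
  have hD0 : ∀ᶠ z in 𝓝 (0 : ℂ), z ∈ D := hDo.mem_nhds (zero_mem_starDomain ha)
  obtain ⟨g, hg⟩ := exists_hasSer (han (f := fun w => (Y w).1) hYd.fst)
  have hg1 : HasSer (fun z => (Y z).2) (fun n => (n + ((N : ℂ) + 1)) • g n) := by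
    refine ((hg.theta.add (hg.const_smul ((N : ℂ) + 1))).congr ?_).congr_coeff fun n => ?_
    · filter_upwards [hD0] with z hz using hY1 z hz
    · exact (add_smul _ _ _).symm
  have hg2 := (hg1.theta.add (hg1.const_smul ((N : ℂ) + 1))).congr_coeff
    (d := fun n => (n + ((N : ℂ) + 1)) • (n + ((N : ℂ) + 1)) • g n) fun n => (add_smul _ _ _).symm
  have hl := hasSer_euler (a := a) (q := q) hε hg hg1 hg2
  have hr : HasSer (fun z : ℂ => ρ₀ + z • ρ₁)
      (fun n => if n = 0 then ρ₀ else if n = 1 then ρ₁ else 0) := by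
    refine Eventually.of_forall fun z => ?_
    rw [← hasSum_nat_add_iff' 2]
    simp [Finset.sum_range_succ]
  have hc := (hl.congr (by filter_upwards [hD0] with z hz using hY2 z hz)).unique hr
  have hcancel : ∀ n : ℕ, ∀ u v : A,
      pA a γ (n + ((N : ℂ) + 1)) * u = pA a γ (n + ((N : ℂ) + 1)) * v → u = v := by
    intro n u v h
    refine pA_mul_cancel ha (k := n + (N + 1)) ?_ (by push_cast; exact h)
    push_cast
    have : (0 : ℝ) ≤ n := n.cast_nonneg
    linarith
  have hgx : ∀ n, g n = x n ∧ g (n + 1) = x (n + 1) := by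
    intro n
    induction n with
    | zero =>
      have h0 := hc 0
      have h1 := hc 1
      simp only [shift, if_true, sub_zero, hρ₀, one_ne_zero, if_false] at h0 h1
      have g0 : g 0 = x 0 := hcancel 0 _ _ (by simpa using h0)
      refine ⟨g0, hcancel 1 _ _ ?_⟩
      rw [g0, hρ₁] at h1
      simpa using h1
    | succ n ih =>
      refine ⟨ih.2, hcancel (n + 2) _ _ ?_⟩
      have h2 := hc (n + 2)
      simp only [shift] at h2
      have e1 : ¬ (n + 1 + 1 = 0) := by omega
      have e2 : ¬ (n + 1 + 1 = 1) := by omega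
      rw [if_neg e1, if_neg e2, sub_eq_zero, ih.1, ih.2] at h2
      push_cast at h2 ⊢
      exact h2.trans (hx n).symm
  exact ⟨_, hYd.fst, hg.congr_coeff fun n => (hgx n).1⟩

/-- A solution of Heun's recurrence in a commutative Banach algebra is the sequence of Taylor
coefficients of an analytic function on the star domain. -/
theorem exists_analytic_of_recurrence {a : ℂ} (ha : a ≠ 0) {q α β γ δ ε : A}
    (hε : α + β + 1 = γ + δ + ε) {c : ℕ → A}
    (hc : ∀ n : ℕ, pA a γ (n + 2) * c (n + 2) =
      qA a q γ δ ε (n + 1) * c (n + 1) + rA α β n * c n) :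
    ∃ F : ℂ → A, DifferentiableOn ℂ F (starDomain a) ∧ HasSer F c := by
  obtain ⟨N, hN⟩ := exists_nat_ge (max ‖γ - 1‖ (2 * ‖(ContinuousLinearMap.snd ℂ A A).prod
      ((ContinuousLinearMap.mul ℂ A (1 - γ)) ∘L (ContinuousLinearMap.snd ℂ A A))‖))
  obtain ⟨hN1, hN2⟩ := max_le_iff.1 hN
  obtain ⟨G, hG, hGx⟩ := exists_tail_continuation ha hε (N := N) (x := fun n => c (n + (N + 1)))
    (fun n => by
      have := hc (n + (N + 1))
      push_cast at this
      rw [show n + 2 + (N + 1) = n + (N + 1) + 2 by ring,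
        show n + 1 + (N + 1) = n + (N + 1) + 1 by ring,
        show (n : ℂ) + 2 + (N + 1) = n + (N + 1) + 2 by ring,
        show (n : ℂ) + 1 + (N + 1) = n + (N + 1) + 1 by ring]
      exact this)
    (by linarith) (by linarith)
  refine ⟨_, ?_, hGx.of_tail (N + 1)⟩
  fun_prop

end Algebra

/-! ### Holomorphic dependence on parameters -/

section Parameters

open Set Metric

variable {X : Type*} [NormedAddCommGroup X]

open Classical in
/-- Extension by zero of a function on a closed ball. -/
noncomputable def extend {x₀ : X} {ρ : ℝ} (f : C(closedBall x₀ ρ, ℂ)) (x : X) : ℂ :=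
  if h : x ∈ closedBall x₀ ρ then f ⟨x, h⟩ else 0

lemma extend_apply {x₀ : X} {ρ : ℝ} (f : C(closedBall x₀ ρ, ℂ)) {x : X}
    (h : x ∈ closedBall x₀ ρ) : extend f x = f ⟨x, h⟩ := by
  rw [extend, dif_pos h]

lemma extend_sub {x₀ : X} {ρ : ℝ} (f g : C(closedBall x₀ ρ, ℂ)) :
    extend (f - g) = extend f - extend g := by
  funext x
  simp only [extend, Pi.sub_apply]
  split_ifs <;> simp

variable [ProperSpace X]

instance compactSpace_closedBall (x₀ : X) (ρ : ℝ) : CompactSpace (closedBall x₀ ρ) :=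
  isCompact_iff_compactSpace.1 (isCompact_closedBall x₀ ρ)

lemma norm_extend_le {x₀ : X} {ρ : ℝ} (f : C(closedBall x₀ ρ, ℂ)) (x : X) :
    ‖extend f x‖ ≤ ‖f‖ := by
  rw [extend]
  split_ifs with h
  · exact f.norm_coe_le_norm _
  · simp

variable [NormedSpace ℂ X]

/-- The algebra of continuous functions on a closed ball that are holomorphic inside. -/
noncomputable def holAlgebra (x₀ : X) (ρ : ℝ) : Subalgebra ℂ C(closedBall x₀ ρ, ℂ) where
  carrier := {f | DifferentiableOn ℂ (extend f) (ball x₀ ρ)}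
  mul_mem' {f g} hf hg := (hf.mul hg).congr fun x hx => by
    simp [extend_apply _ (ball_subset_closedBall hx)]
  add_mem' {f g} hf hg := (hf.add hg).congr fun x hx => by
    simp [extend_apply _ (ball_subset_closedBall hx)]
  algebraMap_mem' r := (differentiableOn_const r).congr fun x hx => by
    simp [extend_apply _ (ball_subset_closedBall hx)]

lemma norm_fderiv_extend_le {x₀ : X} {ρ : ℝ} {f : C(closedBall x₀ ρ, ℂ)}
    (hf : f ∈ holAlgebra x₀ ρ) {x : X} {r : ℝ} (hr : 0 < r) (h : ball x r ⊆ ball x₀ ρ) :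
    ‖fderiv ℂ (extend f) x‖ ≤ 2 * ‖f‖ / r := by
  refine Complex.norm_fderiv_le_div_of_mapsTo_ball (DifferentiableOn.mono hf h) (fun y _ => ?_) hr
  rw [mem_closedBall, dist_eq_norm]
  have h1 := norm_sub_le (extend f y) (extend f x)
  have h2 := norm_extend_le f y
  have h3 := norm_extend_le f x
  linarith

/-- A uniform limit of holomorphic functions of several variables is holomorphic, since the Cauchy
estimate makes the derivatives converge locally uniformly. -/
lemma isClosed_holAlgebra (x₀ : X) (ρ : ℝ) :
    IsClosed (holAlgebra x₀ ρ : Set C(closedBall x₀ ρ, ℂ)) := by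
  refine IsSeqClosed.isClosed fun u f hu hf => ?_
  intro x hx
  obtain ⟨r, hr, hrx⟩ := Metric.isOpen_iff.1 isOpen_ball x hx
  have hb : ∀ y ∈ ball x (r / 2), ball y (r / 2) ⊆ ball x₀ ρ := fun y hy =>
    (ball_subset_ball' (by rw [mem_ball] at hy; linarith)).trans hrx
  have hcau := hf.cauchySeq
  have hbound : ∀ n m, ∀ y ∈ ball x (r / 2),
      ‖fderiv ℂ (extend (u n)) y - fderiv ℂ (extend (u m)) y‖ ≤ 2 * ‖u n - u m‖ / (r / 2) := by
    intro n m y hy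
    have hy0 : y ∈ ball x₀ ρ := hb y hy (mem_ball_self (by linarith))
    have hd : ∀ k, DifferentiableAt ℂ (extend (u k)) y := fun k =>
      DifferentiableOn.differentiableAt (hu k) (isOpen_ball.mem_nhds hy0)
    rw [← fderiv_sub (hd n) (hd m), ← extend_sub]
    exact norm_fderiv_extend_le ((holAlgebra x₀ ρ).sub_mem (hu n) (hu m)) (by linarith) (hb y hy)
  have huc : UniformCauchySeqOn (fun n => fderiv ℂ (extend (u n))) atTop (ball x (r / 2)) := by
    rw [Metric.uniformCauchySeqOn_iff]
    intro e he
    obtain ⟨N, hN⟩ := Metric.cauchySeq_iff.1 hcau (e * (r / 2) / 2) (by positivity)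
    refine ⟨N, fun m hm n hn y hy => ?_⟩
    rw [dist_eq_norm]
    refine (hbound m n y hy).trans_lt ?_
    have := hN m hm n hn
    rw [dist_eq_norm] at this
    rw [div_lt_iff₀ (by linarith)]
    linarith
  have hlim : ∀ y, ∃ L, y ∈ ball x (r / 2) →
      Tendsto (fun n => fderiv ℂ (extend (u n)) y) atTop (𝓝 L) := by
    intro y
    by_cases hy : y ∈ ball x (r / 2)
    · obtain ⟨L, hL⟩ := cauchySeq_tendsto_of_complete (huc.cauchySeq hy)
      exact ⟨L, fun _ => hL⟩
    · exact ⟨0, fun h => absurd h hy⟩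
  choose g' hg' using hlim
  have hx2 : x ∈ ball x (r / 2) := mem_ball_self (by linarith)
  refine (hasFDerivAt_of_tendstoUniformlyOn isOpen_ball
    (huc.tendstoUniformlyOn_of_tendsto fun y hy => hg' y hy) (fun n y hy => ?_)
    (fun y hy => ?_) hx2 (f := fun n => extend (u n))
    (g := extend f)).differentiableAt.differentiableWithinAt
  · have hy0 : y ∈ ball x₀ ρ := hb y hy (mem_ball_self (by linarith))
    exact (DifferentiableOn.differentiableAt (hu n) (isOpen_ball.mem_nhds hy0)).hasFDerivAt
  · have hy0 := ball_subset_closedBall (hb y hy (mem_ball_self (by linarith)))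
    simp only [extend_apply _ hy0]
    exact ((ContinuousMap.evalCLM ℂ (⟨y, hy0⟩ : closedBall x₀ ρ)).continuous.tendsto f).comp hf

/-- A function holomorphic near a closed ball, as an element of `holAlgebra`. -/
noncomputable def toHol {x₀ : X} {ρ : ℝ} (f : X → ℂ)
    (hf : ∀ x ∈ closedBall x₀ ρ, DifferentiableAt ℂ f x) : holAlgebra x₀ ρ :=
  ⟨⟨fun x => f x, continuous_iff_continuousAt.2 fun x =>
    (hf x x.2).continuousAt.comp continuous_subtype_val.continuousAt⟩, by
    intro x hx
    refine (DifferentiableWithinAt.congr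
      (hf x (ball_subset_closedBall hx)).differentiableWithinAt (fun y hy => ?_) ?_)
    · rw [extend_apply _ (ball_subset_closedBall hy)]; rfl
    · rw [extend_apply _ (ball_subset_closedBall hx)]; rfl⟩

/-- The derivative at the centre in a given direction is a bounded functional on `holAlgebra`. -/
noncomputable def fderivFunctional (x₀ : X) {ρ : ℝ} (hρ : 0 < ρ) (v : X) :
    holAlgebra x₀ ρ →L[ℂ] ℂ :=
  LinearMap.mkContinuous
    { toFun := fun f => fderiv ℂ (extend f.1) x₀ v
      map_add' := fun f g => by
        have hd : ∀ h : holAlgebra x₀ ρ, DifferentiableAt ℂ (extend h.1) x₀ := fun h =>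
          DifferentiableOn.differentiableAt h.2 (ball_mem_nhds x₀ hρ)
        rw [← add_apply, ← fderiv_add (hd f) (hd g)]
        congr 2
        funext x
        simp only [extend, Pi.add_apply]
        split_ifs <;> simp
      map_smul' := fun k f => by
        have hd : ∀ h : holAlgebra x₀ ρ, DifferentiableAt ℂ (extend h.1) x₀ := fun h =>
          DifferentiableOn.differentiableAt h.2 (ball_mem_nhds x₀ hρ)
        rw [RingHom.id_apply, ← smul_apply, ← fderiv_const_smul (hd f) k]
        congr 2
        funext x
        simp only [extend, Pi.smul_apply]
        split_ifs <;> simp }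
    (2 / ρ * ‖v‖) fun f => by
      refine ((fderiv ℂ (extend f.1) x₀).le_opNorm v).trans ?_
      have := norm_fderiv_extend_le f.2 hρ Subset.rfl
      calc _ ≤ 2 * ‖f.1‖ / ρ * ‖v‖ := by gcongr
        _ = _ := by rw [show ‖f‖ = ‖f.1‖ from rfl]; ring

/-- **Continuation with parameters.** If the coefficients of a Heun series depend holomorphically on
parameters in a neighbourhood of a closed ball, then so does its analytic continuation, and
derivatives with respect to the parameters can be taken termwise. -/
theorem continuation_parameters {a : ℂ} (ha : a ≠ 0) {δ : ℂ} {q α β γ : X → ℂ} {c : ℕ → X → ℂ}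
    {x₀ : X} {ρ : ℝ} (hρ : 0 < ρ)
    (hq : ∀ x ∈ closedBall x₀ ρ, DifferentiableAt ℂ q x)
    (hα : ∀ x ∈ closedBall x₀ ρ, DifferentiableAt ℂ α x)
    (hβ : ∀ x ∈ closedBall x₀ ρ, DifferentiableAt ℂ β x)
    (hγ : ∀ x ∈ closedBall x₀ ρ, DifferentiableAt ℂ γ x)
    (hc : ∀ n, ∀ x ∈ closedBall x₀ ρ, DifferentiableAt ℂ (c n) x)
    (hrec : ∀ n, ∀ x ∈ closedBall x₀ ρ, P a (γ x) (n + 2) * c (n + 2) x =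
      Q a (q x) (α x) (β x) (γ x) δ (n + 2) * c (n + 1) x + R (α x) (β x) (n + 2) * c n x) :
    (∀ x ∈ closedBall x₀ ρ,
      IsContinuation a (fun n => c n x) (continuation a fun n => c n x)) ∧
    (∀ z ∈ starDomain a,
      DifferentiableOn ℂ (fun x => continuation a (fun n => c n x) z) (ball x₀ ρ)) ∧
    ∀ v : X, IsContinuation a (fun n => fderiv ℂ (c n) x₀ v)
      (fun z => fderiv ℂ (fun x => continuation a (fun n => c n x) z) x₀ v) := by
  have : CompleteSpace (holAlgebra x₀ ρ) := (isClosed_holAlgebra x₀ ρ).completeSpace_coe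
  obtain ⟨F, hFd, hF⟩ := exists_analytic_of_recurrence (A := holAlgebra x₀ ρ) ha
    (q := toHol q hq) (α := toHol α hα) (β := toHol β hβ) (γ := toHol γ hγ)
    (δ := algebraMap ℂ _ δ)
    (ε := toHol α hα + toHol β hβ + 1 - toHol γ hγ - algebraMap ℂ _ δ)
    (c := fun n => toHol (c n) (hc n)) (by ring) (fun n => by
      refine Subtype.ext (ContinuousMap.ext fun x => ?_)
      have := hrec n x x.2
      simp only [P, Q, R, eps] at this
      simp only [pA, qA, rA, toHol]
      simp [Algebra.algebraMap_eq_smul_one]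
      push_cast at this
      linear_combination this)
  have hDo := isOpen_starDomain ha
  have hmap : ∀ L : holAlgebra x₀ ρ →L[ℂ] ℂ,
      IsContinuation a (fun n => L (toHol (c n) (hc n))) (fun z => L (F z)) := fun L =>
    isContinuation_iff.2
      ⟨(L.differentiable.comp_differentiableOn hFd).analyticOnNhd hDo, hF.map L⟩
  have hev : ∀ x (hx : x ∈ closedBall x₀ ρ),
      IsContinuation a (fun n => c n x) (fun z => extend (F z).1 x) := by
    intro x hx
    have := hmap ((ContinuousMap.evalCLM ℂ (⟨x, hx⟩ : closedBall x₀ ρ)).comp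
      ⟨(holAlgebra x₀ ρ).val.toLinearMap, continuous_subtype_val⟩)
    simp only [extend_apply _ hx]
    exact this
  have heq : ∀ z ∈ starDomain a, Set.EqOn (fun x => continuation a (fun n => c n x) z)
      (extend (F z).1) (ball x₀ ρ) := fun z hz x hx =>
    (hev x (ball_subset_closedBall hx)).continuation_eq ha hz
  refine ⟨fun x hx => isContinuation_continuation (hev x hx), fun z hz => ?_, fun v => ?_⟩
  · exact DifferentiableOn.congr (F z).2 (heq z hz)
  · have h1 := hmap (fderivFunctional x₀ hρ v)
    have h2 : ∀ n, fderivFunctional x₀ hρ v (toHol (c n) (hc n)) = fderiv ℂ (c n) x₀ v := by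
      intro n
      have e : extend (toHol (c n) (hc n)).1 =ᶠ[𝓝 x₀] c n := by
        filter_upwards [ball_mem_nhds x₀ hρ] with x hx
        rw [extend_apply _ (ball_subset_closedBall hx)]
        rfl
      exact congrArg (fun L : X →L[ℂ] ℂ => L v) e.fderiv_eq
    have h3 : ∀ z ∈ starDomain a, fderivFunctional x₀ hρ v (F z) =
        fderiv ℂ (fun x => continuation a (fun n => c n x) z) x₀ v := by
      intro z hz
      have e : (fun x => continuation a (fun n => c n x) z) =ᶠ[𝓝 x₀] extend (F z).1 := by
        filter_upwards [ball_mem_nhds x₀ hρ] with x hx using heq z hz hx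
      exact congrArg (fun L : X →L[ℂ] ℂ => L v) e.fderiv_eq.symm
    rw [isContinuation_iff] at h1 ⊢
    refine ⟨h1.1.congr hDo h3, (h1.2.congr ?_).congr_coeff h2⟩
    filter_upwards [hDo.mem_nhds (zero_mem_starDomain ha)] with z hz using h3 z hz

end Parameters

/-! ### The local Heun function as a function of its parameters -/

section Local

open Set Metric

variable {Y : Type*} [NormedAddCommGroup Y] [NormedSpace ℂ Y]

/-- `γ` is not a pole of the local Heun function. -/
def Regular (γ : ℂ) : Prop := ∀ n : ℕ, γ ≠ -(n : ℂ)

lemma isOpen_regular : IsOpen {γ : ℂ | Regular γ} := by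
  have h1 : IsClosed (range fun n : ℕ => ((n : ℝ) : ℂ)) :=
    (Complex.isometry_ofReal.isClosedEmbedding.comp
      Nat.isClosedEmbedding_coe_real).isClosed_range
  have h2 : {γ : ℂ | Regular γ} = (fun γ => -γ) ⁻¹' (range fun n : ℕ => ((n : ℝ) : ℂ))ᶜ := by
    ext γ
    simp only [Regular, mem_ofPred_eq, mem_preimage, mem_compl_iff, mem_range, not_exists,
      Complex.ofReal_natCast]
    exact forall_congr' fun n =>
      not_congr ⟨fun h => by rw [h, neg_neg], fun h => by rw [h, neg_neg]⟩
  rw [h2]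
  exact h1.isOpen_compl.preimage continuous_neg

lemma P_ne_zero {a γ : ℂ} (ha : a ≠ 0) {n : ℕ} (h : γ ≠ -(n : ℂ)) : P a γ (n + 1) ≠ 0 := by
  refine mul_ne_zero (mul_ne_zero ha (by exact_mod_cast n.succ_ne_zero)) fun h0 => h ?_
  push_cast at h0
  linear_combination h0

lemma differentiableAt_P {a : ℂ} {γ : Y → ℂ} {y : Y} (hγ : DifferentiableAt ℂ γ y) (n : ℕ) :
    DifferentiableAt ℂ (fun y => P a (γ y) n) y := by
  simp only [P]
  fun_prop

lemma differentiableAt_div_P {a : ℂ} (ha : a ≠ 0) {f γ : Y → ℂ} {y : Y}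
    (hf : DifferentiableAt ℂ f y) (hγ : DifferentiableAt ℂ γ y) {n : ℕ} (h : γ y ≠ -(n : ℂ)) :
    DifferentiableAt ℂ (fun y => f y / P a (γ y) (n + 1)) y := by
  simp only [div_eq_mul_inv]
  exact hf.mul ((differentiableAt_P hγ (n + 1)).inv (P_ne_zero ha h))

lemma differentiableAt_Q {a δ : ℂ} {q α β γ : Y → ℂ} {y : Y} (hq : DifferentiableAt ℂ q y)
    (hα : DifferentiableAt ℂ α y) (hβ : DifferentiableAt ℂ β y) (hγ : DifferentiableAt ℂ γ y)
    (n : ℕ) : DifferentiableAt ℂ (fun y => Q a (q y) (α y) (β y) (γ y) δ n) y := by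
  simp only [Q, eps]
  fun_prop

lemma differentiableAt_R {α β : Y → ℂ} {y : Y}
    (hα : DifferentiableAt ℂ α y) (hβ : DifferentiableAt ℂ β y) (n : ℕ) :
    DifferentiableAt ℂ (fun y => R (α y) (β y) n) y := by
  simp only [R]
  fun_prop

/-- The coefficient `b m` has poles at most at `γ = 0, -1, …, -(m - 1)`. -/
lemma differentiableAt_coeffL {a δ : ℂ} (ha : a ≠ 0) {q α β γ : Y → ℂ} {y : Y}
    (hq : DifferentiableAt ℂ q y)
    (hα : DifferentiableAt ℂ α y) (hβ : DifferentiableAt ℂ β y) (hγ : DifferentiableAt ℂ γ y)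
    (m : ℕ) (hm : ∀ k < m, γ y ≠ -(k : ℂ)) :
    DifferentiableAt ℂ (fun y => coeffL a (q y) (α y) (β y) (γ y) δ m) y := by
  induction m using Nat.strong_induction_on with
  | _ m ih =>
    match m with
    | 0 => simp only [coeffL]; fun_prop
    | 1 =>
      simp only [coeffL]
      exact differentiableAt_div_P ha (differentiableAt_Q hq hα hβ hγ 1) hγ (hm 0 one_pos)
    | m + 2 =>
      simp only [coeffL]
      exact differentiableAt_div_P ha (((differentiableAt_Q hq hα hβ hγ _).mul
        (ih (m + 1) (by omega) fun k hk => hm k (by omega))).add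
        ((differentiableAt_R hα hβ _).mul (ih m (by omega) fun k hk => hm k (by omega))))
        hγ (hm (m + 1) (by omega))

lemma coeffL_rec {a q α β γ δ : ℂ} (ha : a ≠ 0) {n : ℕ} (h : γ ≠ -((n + 1 : ℕ) : ℂ)) :
    P a γ (n + 2) * coeffL a q α β γ δ (n + 2) =
      Q a q α β γ δ (n + 2) * coeffL a q α β γ δ (n + 1) +
        R α β (n + 2) * coeffL a q α β γ δ n := by
  rw [coeffL, mul_div_cancel₀ _ (P_ne_zero ha h)]

/-- The parameters `(q, α, β, γ)`. -/
abbrev Param : Type := ℂ × ℂ × ℂ × ℂ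

/-- Existence of the local Heun function, holomorphy in the parameters, and termwise
differentiation. -/
lemma heunL_parameters {a : ℂ} (ha : a ≠ 0) (δ : ℂ) {x₀ : Param} (hx₀ : Regular x₀.2.2.2) :
    IsContinuation a (coeffL a x₀.1 x₀.2.1 x₀.2.2.1 x₀.2.2.2 δ)
      (heunL a x₀.1 x₀.2.1 x₀.2.2.1 x₀.2.2.2 δ) ∧
    (∀ z ∈ starDomain a, DifferentiableAt ℂ
      (fun x : Param => heunL a x.1 x.2.1 x.2.2.1 x.2.2.2 δ z) x₀) ∧
    ∀ v : Param, IsContinuation a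
      (fun n => fderiv ℂ (fun x : Param => coeffL a x.1 x.2.1 x.2.2.1 x.2.2.2 δ n) x₀ v)
      (fun z => fderiv ℂ (fun x : Param => heunL a x.1 x.2.1 x.2.2.1 x.2.2.2 δ z) x₀ v) := by
  have ho : IsOpen {x : Param | Regular x.2.2.2} := isOpen_regular.preimage (by fun_prop)
  obtain ⟨ρ, hρ, hsub⟩ := nhds_basis_closedBall.mem_iff.1 (ho.mem_nhds hx₀)
  obtain ⟨h1, h2, h3⟩ := continuation_parameters ha (δ := δ) (q := fun x : Param => x.1)
    (α := fun x => x.2.1) (β := fun x => x.2.2.1) (γ := fun x => x.2.2.2)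
    (c := fun n x => coeffL a x.1 x.2.1 x.2.2.1 x.2.2.2 δ n) hρ
    (fun x _ => by fun_prop) (fun x _ => by fun_prop) (fun x _ => by fun_prop)
    (fun x _ => by fun_prop)
    (fun n x hx => differentiableAt_coeffL ha (by fun_prop) (by fun_prop) (by fun_prop)
      (by fun_prop) n fun k _ => hsub hx k)
    (fun n x hx => coeffL_rec ha (hsub hx (n + 1)))
  exact ⟨h1 x₀ (mem_closedBall_self hρ.le),
    fun z hz => (h2 z hz).differentiableAt (ball_mem_nhds x₀ hρ), h3⟩

lemma isContinuation_heunL {a : ℂ} (ha : a ≠ 0) (q α β δ : ℂ) {γ : ℂ} (hγ : Regular γ) :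
    IsContinuation a (coeffL a q α β γ δ) (heunL a q α β γ δ) :=
  (heunL_parameters ha δ (x₀ := (q, α, β, γ)) hγ).1

lemma differentiableAt_heunL {a δ z : ℂ} (ha : a ≠ 0) (hz : z ∈ starDomain a) {q α β γ : Y → ℂ}
    {y : Y} (hq : DifferentiableAt ℂ q y)
    (hα : DifferentiableAt ℂ α y) (hβ : DifferentiableAt ℂ β y) (hγ : DifferentiableAt ℂ γ y)
    (h : Regular (γ y)) :
    DifferentiableAt ℂ (fun y => heunL a (q y) (α y) (β y) (γ y) δ z) y :=
  DifferentiableAt.comp y (g := fun x : Param => heunL a x.1 x.2.1 x.2.2.1 x.2.2.2 δ z)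
    (f := fun y => (q y, α y, β y, γ y))
    ((heunL_parameters ha δ (x₀ := (q y, α y, β y, γ y)) h).2.1 z hz)
    (hq.prodMk (hα.prodMk (hβ.prodMk hγ)))

lemma differentiableAt_qPrime {a δ : ℂ} {q α β γ : Y → ℂ} {y : Y} (hq : DifferentiableAt ℂ q y)
    (hα : DifferentiableAt ℂ α y) (hβ : DifferentiableAt ℂ β y) (hγ : DifferentiableAt ℂ γ y) :
    DifferentiableAt ℂ (fun y => qPrime a (q y) (α y) (β y) (γ y) δ) y := by
  simp only [qPrime, eps]
  fun_prop

lemma differentiableAt_heunLTransformed {a δ z : ℂ} (ha : a ≠ 0) (hz : z ∈ starDomain a)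
    {q α β γ : Y → ℂ} {y : Y} (hq : DifferentiableAt ℂ q y)
    (hα : DifferentiableAt ℂ α y) (hβ : DifferentiableAt ℂ β y) (hγ : DifferentiableAt ℂ γ y)
    (h : Regular (2 - γ y)) :
    DifferentiableAt ℂ (fun y => heunLTransformed a (q y) (α y) (β y) (γ y) δ z) y := by
  simp only [heunLTransformed]
  exact differentiableAt_heunL ha hz (differentiableAt_qPrime hq hα hβ hγ) (by fun_prop)
    (by fun_prop) (by fun_prop) h

lemma differentiableAt_heunS {a δ z : ℂ} (ha : a ≠ 0) (hz : z ∈ cutDomain a)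
    {q α β γ : Y → ℂ} {y : Y} (hq : DifferentiableAt ℂ q y)
    (hα : DifferentiableAt ℂ α y) (hβ : DifferentiableAt ℂ β y) (hγ : DifferentiableAt ℂ γ y)
    (h : Regular (2 - γ y)) :
    DifferentiableAt ℂ (fun y => heunS a (q y) (α y) (β y) (γ y) δ z) y := by
  simp only [heunS]
  refine DifferentiableAt.mul ?_ (differentiableAt_heunLTransformed ha hz.1 hq hα hβ hγ h)
  exact (hγ.const_sub 1).const_cpow (Or.inl (Complex.slitPlane_ne_zero hz.2))

/-! ### The poles of the local Heun function -/

/-- The coefficients `(γ + n) b (n + 1 + k)` with their removable singularity at `γ = -n`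
removed. -/
noncomputable def poleTail (n : ℕ) (a q α β γ δ : ℂ) : ℕ → ℂ
  | 0 => (Q a q α β γ δ (n + 1) * coeffL a q α β γ δ n
      + R α β (n + 1) * (if n = 0 then 0 else coeffL a q α β γ δ (n - 1))) / (a * (n + 1))
  | 1 => (Q a q α β γ δ (n + 2) * poleTail n a q α β γ δ 0
      + R α β (n + 2) * ((γ + n) * coeffL a q α β γ δ n)) / P a γ (n + 2)
  | k + 2 => (Q a q α β γ δ (n + k + 3) * poleTail n a q α β γ δ (k + 1)
      + R α β (n + k + 3) * poleTail n a q α β γ δ k) / P a γ (n + k + 3)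

/-- The coefficients `(γ + n) b m` with their removable singularity at `γ = -n` removed. -/
noncomputable def poleCoeff (n : ℕ) (a q α β γ δ : ℂ) (m : ℕ) : ℂ :=
  if m ≤ n then (γ + n) * coeffL a q α β γ δ m else poleTail n a q α β γ δ (m - (n + 1))

lemma poleCoeff_of_le {n m : ℕ} (h : m ≤ n) (a q α β γ δ : ℂ) :
    poleCoeff n a q α β γ δ m = (γ + n) * coeffL a q α β γ δ m := if_pos h

lemma poleCoeff_add (n k : ℕ) (a q α β γ δ : ℂ) :
    poleCoeff n a q α β γ δ (n + 1 + k) = poleTail n a q α β γ δ k := by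
  rw [poleCoeff, if_neg (by omega), Nat.add_sub_cancel_left]

lemma ne_neg_of_norm_lt {γ : ℂ} {n k : ℕ} (h : ‖γ + n‖ < 1) (hk : k ≠ n) : γ ≠ -(k : ℂ) := by
  rintro rfl
  have h1 : ‖((n - k : ℤ) : ℂ)‖ < 1 := by
    push_cast
    rwa [show (n : ℂ) - k = -(k : ℂ) + n by ring]
  rw [Complex.norm_intCast, ← Int.cast_abs] at h1
  have h2 : |(n - k : ℤ)| < 1 := by exact_mod_cast h1
  rw [Int.abs_lt_one_iff] at h2
  omega

/-- Unlike that of `coeffL`, this recurrence holds at `γ = -n` too: for `m + 1 = n` both sides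
vanish there. -/
lemma poleCoeff_rec {a q α β γ δ : ℂ} (ha : a ≠ 0) {n : ℕ} (h : ‖γ + n‖ < 1) (m : ℕ) :
    P a γ (m + 2) * poleCoeff n a q α β γ δ (m + 2) =
      Q a q α β γ δ (m + 2) * poleCoeff n a q α β γ δ (m + 1) +
        R α β (m + 2) * poleCoeff n a q α β γ δ m := by
  rcases lt_trichotomy (m + 1) n with hm | hm | hm
  · rw [poleCoeff_of_le (by omega), poleCoeff_of_le (by omega), poleCoeff_of_le (by omega)]
    linear_combination (γ + n) * coeffL_rec (q := q) (α := α) (β := β) (δ := δ) ha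
      (ne_neg_of_norm_lt h (k := m + 1) (by omega))
  · subst hm
    have := poleCoeff_add (m + 1) 0 a q α β γ δ
    rw [show m + 1 + 1 + 0 = m + 2 by rfl] at this
    rw [this, poleCoeff_of_le le_rfl, poleCoeff_of_le (Nat.le_succ m), poleTail,
      if_neg (by omega), Nat.add_sub_cancel, P]
    have h2 : ((m : ℂ) + 1 + 1) ≠ 0 := by exact_mod_cast (m + 1).succ_ne_zero
    push_cast
    rw [show (m : ℂ) + 2 = m + 1 + 1 by ring]
    field_simp
    ring
  · obtain ⟨k, rfl⟩ : ∃ k, m = n + k := ⟨m - n, by omega⟩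
    have hP := P_ne_zero (n := n + k + 1) ha (ne_neg_of_norm_lt h (by omega))
    rw [show n + k + 2 = n + 1 + (k + 1) by ring, show n + k + 1 = n + 1 + k by ring,
      poleCoeff_add, poleCoeff_add]
    rw [show n + k + 1 + 1 = n + 1 + (k + 1) by ring] at hP
    rcases k with _ | k
    · rw [poleCoeff_of_le (by omega), zero_add, poleTail.eq_2, mul_div_cancel₀ _ hP]
      rfl
    · rw [show n + (k + 1) = n + 1 + k by ring, poleCoeff_add, poleTail,
        show n + k + 3 = n + 1 + (k + 1 + 1) by ring, mul_div_cancel₀]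
      exact hP

lemma poleCoeff_of_ne {a q α β γ δ : ℂ} (ha : a ≠ 0) {n : ℕ} (h : ‖γ + n‖ < 1) (h0 : γ ≠ -(n : ℂ))
    (m : ℕ) : poleCoeff n a q α β γ δ m = (γ + n) * coeffL a q α β γ δ m := by
  rcases le_or_gt m n with hm | hm
  · exact poleCoeff_of_le hm ..
  have hreg : Regular γ := fun k => by
    rcases eq_or_ne k n with rfl | hk
    exacts [h0, ne_neg_of_norm_lt h hk]
  have h1 : γ + n ≠ 0 := fun e => h0 (by linear_combination e)
  -- both sides satisfy the same recurrence; the first step fixes the scale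
  have hstart : poleCoeff n a q α β γ δ (n + 1) = (γ + n) * coeffL a q α β γ δ (n + 1) := by
    rw [show n + 1 = n + 1 + 0 by rfl, poleCoeff_add, poleTail]
    have h2 : ((n : ℂ) + 1) ≠ 0 := by exact_mod_cast n.succ_ne_zero
    rcases n with _ | n
    · simp only [coeffL, P, if_true]
      simp only [Nat.cast_zero, add_zero, Nat.cast_one, zero_add] at h1 ⊢
      rw [show γ - 1 + 1 = γ by ring]
      field_simp
      simp
    · simp only [coeffL, P, Nat.add_sub_cancel]
      rw [if_neg (by omega)]
      push_cast at h1 h2 ⊢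
      rw [show γ - 1 + ((n : ℂ) + 2) = γ + (n + 1) by ring, show (n : ℂ) + 2 = n + 1 + 1 by ring]
      field_simp
  have key : ∀ k, poleCoeff n a q α β γ δ (n + k) = (γ + n) * coeffL a q α β γ δ (n + k) ∧
      poleCoeff n a q α β γ δ (n + k + 1) = (γ + n) * coeffL a q α β γ δ (n + k + 1) := by
    intro k
    induction k with
    | zero => exact ⟨poleCoeff_of_le le_rfl .., hstart⟩
    | succ k ih =>
      refine ⟨ih.2, mul_left_cancel₀ (P_ne_zero ha (hreg (n + k + 1))) ?_⟩
      rw [show n + (k + 1) + 1 = n + k + 2 by ring, show n + k + 1 + 1 = n + k + 2 by ring,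
        poleCoeff_rec ha h, ih.1, ih.2]
      linear_combination -(γ + n) * coeffL_rec (q := q) (α := α) (β := β) (δ := δ) ha
        (hreg (n + k + 1))
  obtain ⟨k, rfl⟩ : ∃ k, m = n + k := ⟨m - n, by omega⟩
  exact (key k).1

/-- At `γ = -n` the modified coefficients are `K n` times those of `HeunS`. -/
lemma poleTail_of_eq (a q α β δ : ℂ) (n k : ℕ) :
    poleTail n a q α β (-n) δ k = K a q α β δ n *
      coeffL a (qPrime a q α β (-n) δ) (α - -n + 1) (β - -n + 1) (2 - -n) δ k := by
  have hP : ∀ k : ℕ, P a (2 - -(n : ℂ)) (k + 1) = P a (-n) (n + k + 2) := fun k => by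
    simp only [P]; push_cast; ring
  have hQ : ∀ k : ℕ, Q a (qPrime a q α β (-n) δ) (α - -n + 1) (β - -n + 1) (2 - -n) δ (k + 1) =
      Q a q α β (-n) δ (n + k + 2) := fun k => by
    simp only [Q, qPrime, eps]; push_cast; ring
  have hR : ∀ k : ℕ, R (α - -n + 1) (β - -n + 1) (k + 1) = R α β (n + k + 2) := fun k => by
    simp only [R]; push_cast; ring
  induction k using Nat.strong_induction_on with
  | _ k ih =>
    match k with
    | 0 => simp only [coeffL, mul_one, poleTail, K]
    | 1 =>
      have e0 := ih 0 one_pos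
      simp only [coeffL] at e0
      rw [poleTail, coeffL, e0, hP 0, hQ 0]
      simp only [add_zero, neg_add_cancel, zero_mul, mul_zero, mul_one]
      ring
    | k + 2 =>
      rw [poleTail, coeffL, ih k (by omega), ih (k + 1) (by omega), hP (k + 1), hQ (k + 1),
        hR (k + 1), show n + (k + 1) + 2 = n + k + 3 by ring]
      ring

lemma differentiableAt_poleTail {a δ : ℂ} (ha : a ≠ 0) {n : ℕ} {x : Param}
    (h : ‖x.2.2.2 + n‖ < 1) (k : ℕ) :
    DifferentiableAt ℂ (fun x : Param => poleTail n a x.1 x.2.1 x.2.2.1 x.2.2.2 δ k) x := by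
  have hb : ∀ m ≤ n, DifferentiableAt ℂ
      (fun x : Param => coeffL a x.1 x.2.1 x.2.2.1 x.2.2.2 δ m) x := fun m hm =>
    differentiableAt_coeffL ha (by fun_prop) (by fun_prop) (by fun_prop)
      (by fun_prop) m fun k hk => ne_neg_of_norm_lt h (by omega)
  have hQ : ∀ m, DifferentiableAt ℂ (fun x : Param => Q a x.1 x.2.1 x.2.2.1 x.2.2.2 δ m) x :=
    fun m => differentiableAt_Q (by fun_prop) (by fun_prop) (by fun_prop) (by fun_prop) m
  have hR : ∀ m, DifferentiableAt ℂ (fun x : Param => R x.2.1 x.2.2.1 m) x :=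
    fun m => differentiableAt_R (by fun_prop) (by fun_prop) m
  have hγ : DifferentiableAt ℂ (fun x : Param => x.2.2.2) x := by fun_prop
  induction k using Nat.strong_induction_on with
  | _ k ih =>
    match k with
    | 0 =>
      simp only [poleTail, div_eq_mul_inv]
      refine DifferentiableAt.fun_mul (((hQ _).mul (hb n le_rfl)).add ((hR _).mul ?_))
        (differentiableAt_const _)
      split_ifs with h0
      · fun_prop
      · exact hb (n - 1) (by omega)
    | 1 =>
      rw [funext fun x : Param => poleTail.eq_2 n a x.1 x.2.1 x.2.2.1 x.2.2.2 δ]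
      exact differentiableAt_div_P ha (((hQ _).mul (ih 0 one_pos)).add
        ((hR _).mul (DifferentiableAt.mul (hγ.add_const _) (hb n le_rfl)))) hγ
        (ne_neg_of_norm_lt h n.succ_ne_self)
    | k + 2 =>
      rw [funext fun x : Param => poleTail.eq_3 n a x.1 x.2.1 x.2.2.1 x.2.2.2 δ k]
      exact differentiableAt_div_P ha
        (((hQ _).mul (ih (k + 1) (by omega))).add ((hR _).mul (ih k (by omega)))) hγ
        (ne_neg_of_norm_lt h (k := n + k + 2) (by omega))

lemma differentiableAt_poleCoeff {a δ : ℂ} (ha : a ≠ 0) {n : ℕ} {x : Param}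
    (h : ‖x.2.2.2 + n‖ < 1) (m : ℕ) :
    DifferentiableAt ℂ (fun x : Param => poleCoeff n a x.1 x.2.1 x.2.2.1 x.2.2.2 δ m) x := by
  simp only [poleCoeff]
  split_ifs with hm
  · exact .mul (by fun_prop) (differentiableAt_coeffL ha (by fun_prop) (by fun_prop) (by fun_prop)
      (by fun_prop) m fun k hk => ne_neg_of_norm_lt h (by omega))
  · exact differentiableAt_poleTail ha h _

/-- The function `(γ + n) HeunL(γ; z)` with its removable singularity at `γ = -n` removed. -/
noncomputable def heunLPole (n : ℕ) (a q α β γ δ z : ℂ) : ℂ :=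
  continuation a (poleCoeff n a q α β γ δ) z

/-- Existence of `heunLPole` and its holomorphy in all parameters, `γ = -n` included. -/
lemma heunLPole_parameters {a : ℂ} (ha : a ≠ 0) (δ : ℂ) {n : ℕ} {x₀ : Param}
    (hx₀ : ‖x₀.2.2.2 + n‖ < 1) :
    IsContinuation a (poleCoeff n a x₀.1 x₀.2.1 x₀.2.2.1 x₀.2.2.2 δ)
      (heunLPole n a x₀.1 x₀.2.1 x₀.2.2.1 x₀.2.2.2 δ) ∧
    ∀ z ∈ starDomain a, DifferentiableAt ℂ
      (fun x : Param => heunLPole n a x.1 x.2.1 x.2.2.1 x.2.2.2 δ z) x₀ := by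
  have ho : IsOpen {x : Param | ‖x.2.2.2 + n‖ < 1} := isOpen_lt (by fun_prop) (by fun_prop)
  obtain ⟨ρ, hρ, hsub⟩ := nhds_basis_closedBall.mem_iff.1 (ho.mem_nhds hx₀)
  obtain ⟨h1, h2, h3⟩ := continuation_parameters ha (δ := δ) (q := fun x : Param => x.1)
    (α := fun x => x.2.1) (β := fun x => x.2.2.1) (γ := fun x => x.2.2.2)
    (c := fun m x => poleCoeff n a x.1 x.2.1 x.2.2.1 x.2.2.2 δ m) hρ
    (fun x _ => by fun_prop) (fun x _ => by fun_prop) (fun x _ => by fun_prop)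
    (fun x _ => by fun_prop)
    (fun m x hx => differentiableAt_poleCoeff ha (hsub hx) m)
    (fun m x hx => poleCoeff_rec ha (hsub hx) m)
  exact ⟨h1 x₀ (mem_closedBall_self hρ.le),
    fun z hz => (h2 z hz).differentiableAt (ball_mem_nhds x₀ hρ)⟩

lemma heunLPole_of_ne {a q α β γ δ z : ℂ} (ha : a ≠ 0) (hz : z ∈ starDomain a) {n : ℕ}
    (h : ‖γ + n‖ < 1) (h0 : γ ≠ -(n : ℂ)) :
    heunLPole n a q α β γ δ z = (γ + n) * heunL a q α β γ δ z := by
  have hreg : Regular γ := fun k => by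
    rcases eq_or_ne k n with rfl | hk
    exacts [h0, ne_neg_of_norm_lt h hk]
  have h1 := isContinuation_iff.1 (isContinuation_heunL ha q α β δ hreg)
  refine IsContinuation.continuation_eq ha (f := fun z => (γ + n) * heunL a q α β γ δ z) ?_ hz
  exact isContinuation_iff.2 ⟨analyticOnNhd_const.mul h1.1,
    (h1.2.const_mul (γ + n)).congr_coeff fun m => (poleCoeff_of_ne ha h h0 m).symm⟩

/-- The residue of `HeunL` at `γ = -n` is `K n` times `HeunS`. -/
lemma heunLPole_of_eq {a q α β δ z : ℂ} (ha : a ≠ 0) (hz : z ∈ starDomain a) (n : ℕ) :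
    heunLPole n a q α β (-n) δ z = K a q α β δ n * heunS a q α β (-n) δ z := by
  have hreg : Regular (2 - -(n : ℂ)) := fun k h => by
    have : ((2 + n + k : ℕ) : ℂ) = 0 := by push_cast; linear_combination h
    norm_cast at this
    omega
  have h1 := isContinuation_iff.1 (isContinuation_heunL ha (qPrime a q α β (-n) δ) (α - -n + 1)
    (β - -n + 1) δ hreg)
  have hpow : ∀ w : ℂ, w ^ (1 - -(n : ℂ)) = w ^ (n + 1) := fun w => by
    rw [← Complex.cpow_natCast]; congr 1; push_cast; ring
  refine IsContinuation.continuation_eq ha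
    (f := fun z => K a q α β δ n * heunS a q α β (-n) δ z) ?_ hz
  simp only [heunS, hpow, heunLTransformed]
  refine isContinuation_iff.2 ⟨analyticOnNhd_const.mul ((analyticOnNhd_id.pow _).mul h1.1), ?_⟩
  have h2 := HasSer.of_tail (c := poleCoeff n a q α β (-n) δ) (n + 1)
    ((h1.2.const_mul (K a q α β δ n)).congr_coeff fun k => by
      rw [add_comm k, poleCoeff_add, poleTail_of_eq])
  refine h2.congr (Eventually.of_forall fun w => ?_)
  dsimp only
  rw [Finset.sum_eq_zero fun m hm => ?_, zero_add, smul_eq_mul]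
  · ring
  · rw [poleCoeff_of_le (by simpa [Nat.lt_succ_iff] using hm), neg_add_cancel, zero_mul, smul_zero]

end Local

/-! ### The regularized function `HeunL☼` -/

section Regularization

open Set Metric

variable {Y : Type*} [NormedAddCommGroup Y] [NormedSpace ℂ Y]

lemma contDiffAt_of_eventually_differentiableAt {f : ℂ → ℂ} {s₀ : ℂ}
    (h : ∀ᶠ s in 𝓝 s₀, DifferentiableAt ℂ f s) : ContDiffAt ℝ ∞ f s₀ :=
  ((Complex.analyticAt_iff_eventually_differentiableAt.2 h).restrictScalars (𝕜 := ℝ)).contDiffAt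

lemma regular_of_re_pos {γ : ℂ} (h : 0 < γ.re) : Regular γ := by
  rintro n rfl
  simp only [Complex.neg_re, Complex.natCast_re] at h
  have : (0 : ℝ) ≤ n := n.cast_nonneg
  linarith

lemma regular_two_sub {γ : ℂ} {n : ℕ} (h : ‖γ + n‖ < 1) : Regular (2 - γ) := by
  refine regular_of_re_pos ?_
  have h1 := (Complex.abs_re_le_norm (γ + n)).trans_lt h
  rw [Complex.add_re, Complex.natCast_re, abs_lt] at h1
  have : (0 : ℝ) ≤ n := n.cast_nonneg
  simp only [Complex.sub_re, Complex.re_ofNat]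
  linarith

lemma differentiableAt_K {a δ : ℂ} (ha : a ≠ 0) {q α β : Y → ℂ} {y : Y}
    (hq : DifferentiableAt ℂ q y) (hα : DifferentiableAt ℂ α y) (hβ : DifferentiableAt ℂ β y)
    (n : ℕ) : DifferentiableAt ℂ (fun y => K a (q y) (α y) (β y) δ n) y := by
  have hb : ∀ m ≤ n, DifferentiableAt ℂ
      (fun y => coeffL a (q y) (α y) (β y) (-n) δ m) y := fun m hm =>
    differentiableAt_coeffL ha hq hα hβ (differentiableAt_const _) m
      fun k hk => ne_neg_of_norm_lt (n := n) (by simp) (by omega)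
  simp only [K, div_eq_mul_inv]
  refine DifferentiableAt.mul (((differentiableAt_Q hq hα hβ (differentiableAt_const _) _).mul
    (hb n le_rfl)).add ((differentiableAt_R hα hβ _).mul ?_)) (differentiableAt_const _)
  split_ifs with h0
  · fun_prop
  · exact hb (n - 1) (by omega)

/-- `(γ + n) HeunL - K n HeunS`, which vanishes on the hyperplane `γ = -n`. -/
noncomputable def poleDefect (n : ℕ) (a δ z : ℂ) (x : Param) : ℂ :=
  heunLPole n a x.1 x.2.1 x.2.2.1 x.2.2.2 δ z -
    K a x.1 x.2.1 x.2.2.1 δ n * heunS a x.1 x.2.1 x.2.2.1 x.2.2.2 δ z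

lemma differentiableAt_poleDefect {a δ z : ℂ} (ha : a ≠ 0) (hz : z ∈ cutDomain a) {n : ℕ}
    {x : Param} (hx : ‖x.2.2.2 + n‖ < 1) : DifferentiableAt ℂ (poleDefect n a δ z) x :=
  ((heunLPole_parameters ha δ hx).2 z hz.1).sub ((differentiableAt_K ha (by fun_prop)
    (by fun_prop) (by fun_prop) n).mul (differentiableAt_heunS ha hz (by fun_prop) (by fun_prop)
      (by fun_prop) (by fun_prop) (regular_two_sub hx)))

lemma poleDefect_of_eq {a δ z : ℂ} (ha : a ≠ 0) (hz : z ∈ cutDomain a) (n : ℕ) (q α β : ℂ) :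
    poleDefect n a δ z (q, α, β, -n) = 0 := by
  rw [poleDefect, heunLPole_of_eq ha hz.1, sub_self]

/-- The value of `HeunL☼` at `γ = -n`: the derivative of `poleDefect` in the direction of `γ`. -/
noncomputable def poleValue (n : ℕ) (a q α β δ z : ℂ) : ℂ :=
  fderiv ℂ (poleDefect n a δ z) (q, α, β, -n) (0, 0, 0, 1)

/-- The direction of approach to `γ = -n` does not matter, since `poleDefect` is constant along the
hyperplane. -/
lemma fderiv_poleDefect {a δ z : ℂ} (ha : a ≠ 0) (hz : z ∈ cutDomain a) (n : ℕ) (q α β : ℂ)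
    (v : ℂ × ℂ × ℂ) : fderiv ℂ (poleDefect n a δ z) (q, α, β, -n) (v.1, v.2.1, v.2.2, 1) =
      poleValue n a q α β δ z := by
  have hd : DifferentiableAt ℂ (poleDefect n a δ z) (q, α, β, -n) :=
    differentiableAt_poleDefect ha hz (by simp)
  have hc : HasDerivAt (fun t : ℂ => ((q + t * v.1, α + t * v.2.1, β + t * v.2.2, -n) : Param))
      (v.1, v.2.1, v.2.2, 0) 0 := by
    have h : ∀ b w : ℂ, HasDerivAt (fun t : ℂ => b + t * w) w 0 := fun b w => by
      simpa using ((hasDerivAt_id (0 : ℂ)).mul_const w).const_add b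
    exact (h q _).prodMk ((h α _).prodMk ((h β _).prodMk (hasDerivAt_const _ _)))
  have h0 : fderiv ℂ (poleDefect n a δ z) (q, α, β, -n) (v.1, v.2.1, v.2.2, 0) = 0 := by
    have hd' : HasFDerivAt (poleDefect n a δ z) (fderiv ℂ (poleDefect n a δ z) (q, α, β, -n))
        ((q + 0 * v.1, α + 0 * v.2.1, β + 0 * v.2.2, -n) : Param) := by
      simpa using hd.hasFDerivAt
    have h1 := hd'.comp_hasDerivAt 0 hc
    refine h1.unique ((hasDerivAt_const (0 : ℂ) (0 : ℂ)).congr_of_eventuallyEq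
      (Eventually.of_forall fun t => ?_))
    exact poleDefect_of_eq ha hz n _ _ _
  have hv : ((v.1, v.2.1, v.2.2, 1) : Param) = (v.1, v.2.1, v.2.2, 0) + (0, 0, 0, 1) := by simp
  rw [hv, map_add, h0, zero_add, poleValue]

/-- Near `γ = -n` the corrected function extends smoothly along every holomorphic family of
parameters, with a value at `γ = -n` that depends on the parameters there only. -/
lemma exists_extension_heunLCorrected {a δ z : ℂ} (ha : a ≠ 0) (hz : z ∈ cutDomain a) (n : ℕ)
    {q α β : ℂ → ℂ} (hq : Differentiable ℂ q) (hα : Differentiable ℂ α) (hβ : Differentiable ℂ β) :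
    ∃ Φ : ℂ → ℂ, ContDiffAt ℝ ∞ Φ (-n) ∧
      Φ (-n) = poleValue n a (q (-n)) (α (-n)) (β (-n)) δ z ∧
      ∀ s : ℂ, s ≠ -n → ‖s + n‖ < 1 →
        heunLCorrected n a (q s) (α s) (β s) s δ z = Φ s := by
  set g : ℂ → Param := fun s => (q s, α s, β s, s) with hg
  have hgd : Differentiable ℂ g := hq.prodMk (hα.prodMk (hβ.prodMk differentiable_id))
  have hev : ∀ᶠ s : ℂ in 𝓝 (-n), ‖s + n‖ < 1 :=
    (isOpen_lt (by fun_prop) (by fun_prop)).mem_nhds (by simp)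
  set f : ℂ → ℂ := fun s => poleDefect n a δ z (g s) with hf
  have hfd : ∀ s : ℂ, ‖s + n‖ < 1 → DifferentiableAt ℂ f s := fun s hs =>
    DifferentiableAt.comp s (differentiableAt_poleDefect ha hz hs) (hgd s)
  have hf0 : f (-n) = 0 := poleDefect_of_eq ha hz n _ _ _
  have hfderiv : deriv f (-n) = poleValue n a (q (-n)) (α (-n)) (β (-n)) δ z := by
    have h1 : HasDerivAt g (deriv q (-n), deriv α (-n), deriv β (-n), 1) (-n) :=
      (hq _).hasDerivAt.prodMk ((hα _).hasDerivAt.prodMk ((hβ _).hasDerivAt.prodMk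
        (hasDerivAt_id _)))
    have h2 : HasFDerivAt (poleDefect n a δ z) (fderiv ℂ (poleDefect n a δ z) (g (-n))) (g (-n)) :=
      (differentiableAt_poleDefect ha hz (by simp [hg])).hasFDerivAt
    refine (h2.comp_hasDerivAt _ h1).deriv.trans ?_
    exact fderiv_poleDefect ha hz n _ _ _ (deriv q (-n), deriv α (-n), deriv β (-n))
  refine ⟨fun s => dslope f (-n) s + (1 - (rho ‖s + n‖ : ℂ)) / (s + n) *
    (K a (q s) (α s) (β s) δ n * heunS a (q s) (α s) (β s) s δ z), ?_, ?_, ?_⟩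
  · refine ContDiffAt.add ?_ (ContDiffAt.mul ?_ ?_)
    · have ho : IsOpen {s : ℂ | ‖s + n‖ < 1} := isOpen_lt (by fun_prop) (by fun_prop)
      have hm : {s : ℂ | ‖s + n‖ < 1} ∈ 𝓝 (-(n : ℂ)) := ho.mem_nhds (by simp)
      have h1 : DifferentiableOn ℂ (dslope f (-n)) {s : ℂ | ‖s + n‖ < 1} :=
        (Complex.differentiableOn_dslope hm).2 fun s hs => (hfd s hs).differentiableWithinAt
      refine contDiffAt_of_eventually_differentiableAt ?_
      filter_upwards [hev] with s hs using h1.differentiableAt (ho.mem_nhds hs)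
    · exact (contDiff_one_sub_rho_div.comp (contDiff_id.add contDiff_const)).contDiffAt
    · refine contDiffAt_of_eventually_differentiableAt ?_
      filter_upwards [hev] with s hs
      exact (differentiableAt_K ha (hq s) (hα s) (hβ s) n).mul (differentiableAt_heunS ha hz
        (hq s) (hα s) (hβ s) differentiableAt_id (regular_two_sub hs))
  · simp [hfderiv]
  · intro s hs hs1
    have hsn : s + n ≠ 0 := fun h => hs (by linear_combination h)
    have h1 : f s = (s + n) * heunL a (q s) (α s) (β s) s δ z -
        K a (q s) (α s) (β s) δ n * heunS a (q s) (α s) (β s) s δ z := by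
      simp only [hf, hg, poleDefect]
      rw [heunLPole_of_ne ha hz.1 hs1 hs]
    simp only [dslope_of_ne _ hs, slope_def_field, hf0, h1, sub_zero, heunLCorrected,
      sub_neg_eq_add]
    field_simp
    ring

lemma tendsto_heunLCorrected {a δ z : ℂ} (ha : a ≠ 0) (hz : z ∈ cutDomain a) (n : ℕ)
    (q α β : ℂ) : Tendsto (fun γ => heunLCorrected n a q α β γ δ z) (𝓝[≠] (-(n : ℂ)))
      (𝓝 (poleValue n a q α β δ z)) := by
  obtain ⟨Φ, hΦ, hv, he⟩ := exists_extension_heunLCorrected (δ := δ) ha hz n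
    (differentiable_const q) (differentiable_const α) (differentiable_const β)
  rw [← hv]
  refine (hΦ.continuousAt.tendsto.mono_left nhdsWithin_le_nhds).congr' ?_
  have hev : ∀ᶠ s : ℂ in 𝓝 (-n), ‖s + n‖ < 1 :=
    (isOpen_lt (by fun_prop) (by fun_prop)).mem_nhds (by simp)
  filter_upwards [self_mem_nhdsWithin, nhdsWithin_le_nhds hev] with s h1 h2
    using (he s h1 h2).symm

/-- The discs of radius `1 / 2` around the points `-n` are disjoint. -/
lemma half_le_norm_add {γ : ℂ} {n k : ℕ} (h : ‖γ + n‖ < 1 / 2) (hk : k ≠ n) :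
    1 / 2 ≤ ‖γ + k‖ := by
  have h1 : (1 : ℝ) ≤ ‖((k - n : ℤ) : ℂ)‖ := by
    rw [Complex.norm_intCast, ← Int.cast_abs]
    have h2 : (1 : ℤ) ≤ |(k : ℤ) - n| := Int.one_le_abs (by omega)
    exact_mod_cast h2
  have h2 := norm_sub_le (γ + k) (γ + n)
  rw [show γ + k - (γ + n) = ((k - n : ℤ) : ℂ) by push_cast; ring] at h2
  linarith

open Classical in
lemma heunLReg_of_lt {a q α β γ δ z : ℂ} {n : ℕ} (h : ‖γ + n‖ < 1 / 2) :
    heunLReg a q α β γ δ z = if γ = -(n : ℂ) then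
      limUnder (𝓝[≠] γ) (fun g => heunLCorrected n a q α β g δ z)
    else heunLCorrected n a q α β γ δ z := by
  have hex : ∃ n : ℕ, ‖γ + n‖ < 1 / 2 := ⟨n, h⟩
  have hn : hex.choose = n := by
    by_contra hne
    exact absurd hex.choose_spec (not_lt.2 (half_le_norm_add h hne))
  rw [heunLReg, dif_pos hex, hn]

lemma heunLReg_center {a δ z : ℂ} (ha : a ≠ 0) (hz : z ∈ cutDomain a) (n : ℕ)
    (q α β : ℂ) : heunLReg a q α β (-n) δ z = poleValue n a q α β δ z := by
  rw [heunLReg_of_lt (n := n) (by simp), if_pos rfl]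
  exact (tendsto_heunLCorrected ha hz n q α β).limUnder_eq

lemma heunLReg_of_half_le {a q α β γ δ z : ℂ} (h : ∀ n : ℕ, 1 / 2 ≤ ‖γ + n‖) :
    heunLReg a q α β γ δ z = heunL a q α β γ δ z := by
  rw [heunLReg, dif_neg]
  rintro ⟨n, hn⟩
  exact absurd hn (not_lt.2 (h n))

/-- Off the centres, all corrections can be subtracted at once, since at most one is nonzero. -/
lemma heunLReg_eq_sum {a q α β γ δ z : ℂ} (h : Regular γ) {m : ℕ} (hm : ‖γ‖ + 1 ≤ m) :
    heunLReg a q α β γ δ z = heunL a q α β γ δ z -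
      ∑ n ∈ Finset.range m, K a q α β δ n / (γ + n) * (rho ‖γ + n‖ : ℂ) *
        heunS a q α β γ δ z := by
  by_cases hex : ∃ n : ℕ, ‖γ + n‖ < 1 / 2
  · obtain ⟨n, hn⟩ := hex
    rw [heunLReg_of_lt hn, if_neg (h n), heunLCorrected, Finset.sum_eq_single n]
    · intro k _ hk
      rw [rho_eq_zero (half_le_norm_add hn hk)]
      simp
    · intro hnm
      exfalso
      rw [Finset.mem_range, not_lt] at hnm
      have h1 : (m : ℝ) ≤ n := by exact_mod_cast hnm
      have h2 := norm_sub_le (γ + n) γ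
      rw [add_sub_cancel_left, Complex.norm_natCast] at h2
      linarith
  · push Not at hex
    rw [heunLReg_of_half_le hex, Finset.sum_eq_zero, sub_zero]
    intro k _
    rw [rho_eq_zero (hex k)]
    simp

lemma contDiff_heunLReg {a δ z : ℂ} (ha : a ≠ 0) (hz : z ∈ cutDomain a)
    {q α β : ℂ → ℂ} (hq : Differentiable ℂ q) (hα : Differentiable ℂ α) (hβ : Differentiable ℂ β) :
    ContDiff ℝ ∞ fun γ => heunLReg a (q γ) (α γ) (β γ) γ δ z := by
  rw [contDiff_iff_contDiffAt]
  intro s₀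
  by_cases hs₀ : Regular s₀
  · obtain ⟨m, hm⟩ := exists_nat_gt (‖s₀‖ + 1)
    have hev1 : ∀ᶠ s in 𝓝 s₀, Regular s := isOpen_regular.mem_nhds hs₀
    have hev2 : ∀ᶠ s : ℂ in 𝓝 s₀, ‖s‖ + 1 < m :=
      (isOpen_lt (by fun_prop) (by fun_prop)).mem_nhds hm
    have key : ContDiffAt ℝ ∞ (fun γ => heunL a (q γ) (α γ) (β γ) γ δ z -
        ∑ n ∈ Finset.range m, K a (q γ) (α γ) (β γ) δ n / (γ + n) * (rho ‖γ + n‖ : ℂ) *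
          heunS a (q γ) (α γ) (β γ) γ δ z) s₀ := by
      refine ContDiffAt.sub ?_ (ContDiffAt.sum fun n _ => ?_)
      · refine contDiffAt_of_eventually_differentiableAt ?_
        filter_upwards [hev1] with s hs
        exact differentiableAt_heunL ha hz.1 (hq s) (hα s) (hβ s) differentiableAt_id hs
      · rcases lt_or_ge (1 / 2) ‖s₀ + n‖ with hn | hn
        · -- here `HeunS` may be singular, but its factor vanishes identically
          refine (contDiffAt_const (c := (0 : ℂ))).congr_of_eventuallyEq ?_
          have : ∀ᶠ s : ℂ in 𝓝 s₀, 1 / 2 < ‖s + n‖ :=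
            (isOpen_lt (by fun_prop) (by fun_prop)).mem_nhds hn
          filter_upwards [this] with s hs
          rw [rho_eq_zero hs.le]
          simp
        · have hev3 : ∀ᶠ s : ℂ in 𝓝 s₀, ‖s + n‖ < 1 :=
            (isOpen_lt (by fun_prop) (by fun_prop)).mem_nhds (hn.trans_lt (by norm_num))
          refine ContDiffAt.mul (ContDiffAt.mul ?_ ?_) ?_
          · refine contDiffAt_of_eventually_differentiableAt ?_
            filter_upwards [hev1] with s hs
            exact (differentiableAt_K ha (hq s) (hα s) (hβ s) n).div (by fun_prop)
              fun h => hs n (by linear_combination h)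
          · exact (contDiff_rho_norm.comp (contDiff_id.add contDiff_const)).contDiffAt
          · refine contDiffAt_of_eventually_differentiableAt ?_
            filter_upwards [hev3] with s hs
            exact differentiableAt_heunS ha hz (hq s) (hα s) (hβ s) differentiableAt_id
              (regular_two_sub hs)
    refine key.congr_of_eventuallyEq ?_
    filter_upwards [hev1, hev2] with s h1 h2 using heunLReg_eq_sum h1 h2.le
  · obtain ⟨n, rfl⟩ : ∃ n : ℕ, s₀ = -n := by
      simpa [Regular] using hs₀
    obtain ⟨Φ, hΦ, hv, he⟩ := exists_extension_heunLCorrected (δ := δ) ha hz n hq hα hβ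
    refine hΦ.congr_of_eventuallyEq ?_
    have hev : ∀ᶠ s : ℂ in 𝓝 (-n), ‖s + n‖ < 1 / 2 :=
      (isOpen_lt (by fun_prop) (by fun_prop)).mem_nhds (by simp)
    filter_upwards [hev] with s hs
    rcases eq_or_ne s (-n) with rfl | hne
    · rw [heunLReg_center ha hz, hv]
    · rw [heunLReg_of_lt hs, if_neg hne, he s hne (hs.trans (by norm_num))]

end Regularization

/-! ### The regularized function `HeunS☼` -/

section SecondSolution

open Set Metric

lemma qPrime_one (a q α β δ : ℂ) : qPrime a q α β 1 δ = q := by simp [qPrime]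

lemma heunLTransformed_one (a q α β δ z : ℂ) :
    heunLTransformed a q α β 1 δ z = heunL a q α β 1 δ z := by
  simp only [heunLTransformed, qPrime_one]
  norm_num

lemma heunSRing_of_lt {a q α β γ δ z : ℂ} (h : ‖γ - 1‖ ≤ 1 / 2) :
    heunSRing a q α β γ δ z = heunS a q α β γ δ z := by
  rw [heunSRing, heunS, heunLTransformed, heunLReg_of_half_le]
  intro n
  have h1 := Complex.abs_re_le_norm (γ - 1)
  have h2 := Complex.re_le_norm (2 - γ + n)
  have h3 : (0 : ℝ) ≤ n := n.cast_nonneg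
  simp only [Complex.sub_re, Complex.add_re, Complex.re_ofNat, Complex.natCast_re,
    Complex.one_re] at h1 h2
  have := abs_le.1 (h1.trans h)
  linarith

lemma contDiff_heunSRing {a z : ℂ} (ha : a ≠ 0) (hz : z ∈ cutDomain a) (q α β δ : ℂ) :
    ContDiff ℝ ∞ fun γ => heunSRing a q α β γ δ z := by
  have h1 := contDiff_heunLReg (δ := δ) ha hz
    (q := fun s => qPrime a q α β (2 - s) δ) (α := fun s => α - (2 - s) + 1)
    (β := fun s => β - (2 - s) + 1)
    (fun s => differentiableAt_qPrime (by fun_prop) (by fun_prop) (by fun_prop) (by fun_prop))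
    (by fun_prop) (by fun_prop)
  have h2 : ContDiff ℝ ∞ fun γ : ℂ => (2 : ℂ) - γ := contDiff_const.sub contDiff_id
  have h3 : ContDiff ℝ ∞ fun γ : ℂ => z ^ (1 - γ) := by
    rw [contDiff_iff_contDiffAt]
    refine fun s => contDiffAt_of_eventually_differentiableAt (Eventually.of_forall fun t => ?_)
    exact DifferentiableAt.const_cpow (by fun_prop) (Or.inl (Complex.slitPlane_ne_zero hz.2))
  have h4 := h3.mul (h1.comp h2)
  refine (congrArg (ContDiff ℝ ∞) (funext fun γ => ?_)).mpr h4
  simp only [heunSRing, Function.comp_apply, sub_sub_cancel]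

lemma regular_of_norm_sub_one_lt {γ : ℂ} (h : ‖γ - 1‖ < 1) : Regular γ ∧ Regular (2 - γ) := by
  have h1 := (Complex.abs_re_le_norm (γ - 1)).trans_lt h
  rw [Complex.sub_re, Complex.one_re, abs_lt] at h1
  exact ⟨regular_of_re_pos (by linarith),
    regular_of_re_pos (by simp only [Complex.sub_re, Complex.re_ofNat]; linarith)⟩

/-- The difference quotient of the two solutions that coincide at `γ = 1`, with its removable
singularity at `γ = 1` removed. -/
noncomputable def heunSQuotient (a q α β δ z : ℂ) (γ : ℂ) : ℂ :=
  -dslope (fun γ => heunS a q α β γ δ z - heunL a q α β γ δ z) 1 γ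

lemma heunS_one (a q α β δ z : ℂ) : heunS a q α β 1 δ z = heunL a q α β 1 δ z := by
  rw [heunS, heunLTransformed_one, sub_self, Complex.cpow_zero, one_mul]

lemma heunSQuotient_of_ne {a q α β γ δ z : ℂ} (h : γ ≠ 1) : heunSQuotient a q α β δ z γ =
    (heunS a q α β γ δ z - heunL a q α β γ δ z) / (1 - γ) := by
  rw [heunSQuotient, dslope_of_ne _ h, slope_def_field, heunS_one, sub_self, sub_zero, ← div_neg,
    neg_sub]

lemma differentiableAt_heunSQuotient {a z : ℂ} (ha : a ≠ 0) (hz : z ∈ cutDomain a)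
    (q α β δ : ℂ) {γ : ℂ} (hγ : ‖γ - 1‖ < 1) :
    DifferentiableAt ℂ (heunSQuotient a q α β δ z) γ := by
  have ho : IsOpen {s : ℂ | ‖s - 1‖ < 1} := isOpen_lt (by fun_prop) (by fun_prop)
  have hm : {s : ℂ | ‖s - 1‖ < 1} ∈ 𝓝 (1 : ℂ) := ho.mem_nhds (by simp)
  have h1 := (Complex.differentiableOn_dslope hm
    (f := fun γ => heunS a q α β γ δ z - heunL a q α β γ δ z)).2 fun s hs => by
      obtain ⟨r1, r2⟩ := regular_of_norm_sub_one_lt hs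
      exact ((differentiableAt_heunS ha hz (by fun_prop) (by fun_prop) (by fun_prop) (by fun_prop)
        r2).sub (differentiableAt_heunL ha hz.1 (by fun_prop) (by fun_prop) (by fun_prop)
        (by fun_prop) r1)).differentiableWithinAt
  exact (h1.differentiableAt (ho.mem_nhds hγ)).neg

lemma differentiableAt_heunL_one {a z : ℂ} (ha : a ≠ 0) (hz : z ∈ starDomain a) (q α β δ : ℂ) :
    DifferentiableAt ℂ (fun γ : ℂ => heunL a q α β γ δ z) 1 :=
  differentiableAt_heunL ha hz (by fun_prop) (by fun_prop) (by fun_prop) (by fun_prop)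
    (regular_of_norm_sub_one_lt (by simp)).1

lemma differentiableAt_heunLTransformed_one {a z : ℂ} (ha : a ≠ 0) (hz : z ∈ starDomain a)
    (q α β δ : ℂ) : DifferentiableAt ℂ (fun γ : ℂ => heunLTransformed a q α β γ δ z) 1 :=
  differentiableAt_heunLTransformed ha hz (by fun_prop) (by fun_prop) (by fun_prop) (by fun_prop)
    (regular_of_norm_sub_one_lt (by simp)).2

lemma heunSQuotient_one {a z : ℂ} (ha : a ≠ 0) (hz : z ∈ cutDomain a) (q α β δ : ℂ) :
    heunSQuotient a q α β δ z 1 = Complex.log z * heunL a q α β 1 δ z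
      - (deriv (fun γ : ℂ => heunLTransformed a q α β γ δ z) 1
        - deriv (fun γ : ℂ => heunL a q α β γ δ z) 1) := by
  have h1 : HasDerivAt (fun γ : ℂ => z ^ (1 - γ)) (-Complex.log z) 1 := by
    have := ((hasDerivAt_id (1 : ℂ)).const_sub 1).const_cpow (c := z)
      (Or.inl (Complex.slitPlane_ne_zero hz.2))
    simpa using this
  have h2 := ((h1.mul (differentiableAt_heunLTransformed_one ha hz.1 q α β δ).hasDerivAt).sub
    (differentiableAt_heunL_one ha hz.1 q α β δ).hasDerivAt).deriv
  rw [heunSQuotient, dslope_same]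
  simp only [heunS]
  refine (congrArg Neg.neg h2).trans ?_
  rw [heunLTransformed_one, sub_self, Complex.cpow_zero]
  ring

lemma heunSCorrected_eq {a q α β γ δ z : ℂ} (h : γ ≠ 1) (h' : ‖γ - 1‖ ≤ 1 / 2) :
    heunSCorrected a q α β γ δ z = (rho ‖γ - 1‖ : ℂ) * heunSQuotient a q α β δ z γ
      + (1 - (rho ‖γ - 1‖ : ℂ)) * heunSRing a q α β γ δ z := by
  rw [heunSCorrected, heunSQuotient_of_ne h, heunSRing_of_lt h', one_div_mul_eq_div]

/-- The function that `heunSReg` agrees with near `γ = 1`; its continuity also provides the limit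
at `γ = 1`. -/
lemma contDiffAt_glue {a z : ℂ} (ha : a ≠ 0) (hz : z ∈ cutDomain a) (q α β δ : ℂ) {γ : ℂ}
    (hγ : ‖γ - 1‖ < 1) :
    ContDiffAt ℝ ∞ (fun γ => (rho ‖γ - 1‖ : ℂ) * heunSQuotient a q α β δ z γ
      + (1 - (rho ‖γ - 1‖ : ℂ)) * heunSRing a q α β γ δ z) γ := by
  have hr : ContDiffAt ℝ ∞ (fun γ : ℂ => (rho ‖γ - 1‖ : ℂ)) γ :=
    (contDiff_rho_norm.comp (contDiff_id.sub contDiff_const)).contDiffAt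
  have hev : ∀ᶠ s : ℂ in 𝓝 γ, ‖s - 1‖ < 1 :=
    (isOpen_lt (by fun_prop) (by fun_prop)).mem_nhds hγ
  refine (hr.mul (contDiffAt_of_eventually_differentiableAt ?_)).add
    ((contDiffAt_const.sub hr).mul (contDiff_heunSRing ha hz q α β δ).contDiffAt)
  filter_upwards [hev] with s hs using differentiableAt_heunSQuotient ha hz q α β δ hs

lemma tendsto_heunSCorrected {a z : ℂ} (ha : a ≠ 0) (hz : z ∈ cutDomain a) (q α β δ : ℂ) :
    Tendsto (fun γ : ℂ => heunSCorrected a q α β γ δ z) (𝓝[≠] (1 : ℂ))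
      (𝓝 (heunSQuotient a q α β δ z 1)) := by
  have h := (contDiffAt_glue ha hz q α β δ (γ := 1) (by simp)).continuousAt.tendsto
  simp only [sub_self, norm_zero, rho_zero, Complex.ofReal_one, one_mul, zero_mul, add_zero] at h
  refine (h.mono_left nhdsWithin_le_nhds).congr' ?_
  have hev : ∀ᶠ s : ℂ in 𝓝 1, ‖s - 1‖ < 1 / 2 :=
    (isOpen_lt (by fun_prop) (by fun_prop)).mem_nhds (by simp)
  filter_upwards [self_mem_nhdsWithin, nhdsWithin_le_nhds hev] with s h1 h2
    using (heunSCorrected_eq h1 h2.le).symm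

lemma heunSReg_one {a z : ℂ} (ha : a ≠ 0) (hz : z ∈ cutDomain a) (q α β δ : ℂ) :
    heunSReg a q α β 1 δ z = heunSQuotient a q α β δ z 1 := by
  rw [heunSReg, if_pos (by simp), if_pos rfl]
  exact (tendsto_heunSCorrected ha hz q α β δ).limUnder_eq

/-- Off `γ = 1` the formula of the disc holds everywhere, as `ρ` vanishes outside. -/
lemma heunSReg_of_ne {a q α β γ δ z : ℂ} (h : γ ≠ 1) :
    heunSReg a q α β γ δ z = heunSCorrected a q α β γ δ z := by
  rw [heunSReg]
  split_ifs with h1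
  · rfl
  · rw [heunSCorrected, rho_eq_zero (not_lt.1 h1)]
    simp

lemma contDiff_heunSReg {a z : ℂ} (ha : a ≠ 0) (hz : z ∈ cutDomain a) (q α β δ : ℂ) :
    ContDiff ℝ ∞ fun γ : ℂ => heunSReg a q α β γ δ z := by
  rw [contDiff_iff_contDiffAt]
  intro s₀
  rcases lt_or_ge ‖s₀ - 1‖ 1 with h | h
  · refine (contDiffAt_glue ha hz q α β δ h).congr_of_eventuallyEq
      (Eventually.of_forall fun s => ?_)
    rcases eq_or_ne s 1 with rfl | hs
    · simp [heunSReg_one ha hz, rho_zero]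
    · dsimp only
      rw [heunSReg_of_ne hs]
      rcases le_or_gt ‖s - 1‖ (1 / 2) with h1 | h1
      · exact heunSCorrected_eq hs h1
      · rw [heunSCorrected, rho_eq_zero h1.le]
        simp
  · refine (contDiff_heunSRing ha hz q α β δ).contDiffAt.congr_of_eventuallyEq ?_
    have hev : ∀ᶠ s : ℂ in 𝓝 s₀, 1 / 2 < ‖s - 1‖ :=
      (isOpen_lt (by fun_prop) (by fun_prop)).mem_nhds (lt_of_lt_of_le (by norm_num) h)
    filter_upwards [hev] with s hs
    rw [heunSReg, if_neg (not_lt.2 hs.le)]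

end SecondSolution

/-! ### The logarithmic solution at `γ = 1` -/

section Logarithmic

open Set Metric

lemma regular_one : Regular 1 := regular_of_re_pos (by simp)

/-- Termwise differentiation of `HeunL` along a curve of parameters. -/
lemma isContinuation_deriv {a : ℂ} (ha : a ≠ 0) (δ : ℂ) {g : ℂ → Param} {t : ℂ}
    (hg : DifferentiableAt ℂ g t) (hr : Regular (g t).2.2.2) :
    IsContinuation a
      (fun n => deriv (fun s => coeffL a (g s).1 (g s).2.1 (g s).2.2.1 (g s).2.2.2 δ n) t)
      (fun z => deriv (fun s => heunL a (g s).1 (g s).2.1 (g s).2.2.1 (g s).2.2.2 δ z) t) := by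
  obtain ⟨-, hd, hc⟩ := heunL_parameters ha δ hr
  have h := isContinuation_iff.1 (hc (deriv g t))
  have h1 : ∀ n, fderiv ℂ (fun x : Param => coeffL a x.1 x.2.1 x.2.2.1 x.2.2.2 δ n) (g t)
      (deriv g t) = deriv (fun s => coeffL a (g s).1 (g s).2.1 (g s).2.2.1 (g s).2.2.2 δ n) t :=
    fun n => ((differentiableAt_coeffL (Y := Param) ha (by fun_prop) (by fun_prop) (by fun_prop)
      (by fun_prop) n fun k _ => hr k).hasFDerivAt.comp_hasDerivAt t hg.hasDerivAt).deriv.symm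
  have h2 : ∀ z ∈ starDomain a,
      fderiv ℂ (fun x : Param => heunL a x.1 x.2.1 x.2.2.1 x.2.2.2 δ z) (g t) (deriv g t) =
        deriv (fun s => heunL a (g s).1 (g s).2.1 (g s).2.2.1 (g s).2.2.2 δ z) t :=
    fun z hz => ((hd z hz).hasFDerivAt.comp_hasDerivAt t hg.hasDerivAt).deriv.symm
  have hDo := isOpen_starDomain ha
  refine isContinuation_iff.2 ⟨h.1.congr hDo h2, (h.2.congr ?_).congr_coeff h1⟩
  filter_upwards [hDo.mem_nhds (zero_mem_starDomain ha)] with z hz using h2 z hz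

/-- Differentiating the recurrences of `HeunL` and of the transformed function at `γ = 1`: the
difference of the derivatives of the coefficients satisfies the recurrence of `d`. -/
lemma coeffD_eq {a : ℂ} (ha : a ≠ 0) (q α β δ : ℂ) (n : ℕ) :
    coeffD a q α β δ n = deriv (fun γ => coeffL a q α β γ δ n) 1 -
      deriv (fun γ => coeffL a (qPrime a q α β γ δ) (α - γ + 1) (β - γ + 1) (2 - γ) δ n) 1 := by
  set b : ℕ → ℂ → ℂ := fun n γ => coeffL a q α β γ δ n with hb
  set b' : ℕ → ℂ → ℂ := fun n γ =>
    coeffL a (qPrime a q α β γ δ) (α - γ + 1) (β - γ + 1) (2 - γ) δ n with hb'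
  change coeffD a q α β δ n = deriv (b n) 1 - deriv (b' n) 1
  have hd : ∀ n, HasDerivAt (b n) (deriv (b n) 1) 1 := fun n =>
    (differentiableAt_coeffL (Y := ℂ) ha (by fun_prop) (by fun_prop) (by fun_prop) (by fun_prop) n
      fun k _ => regular_one k).hasDerivAt
  have hd' : ∀ n, HasDerivAt (b' n) (deriv (b' n) 1) 1 := fun n =>
    (differentiableAt_coeffL (Y := ℂ) ha (differentiableAt_qPrime (by fun_prop) (by fun_prop)
      (by fun_prop) (by fun_prop)) (by fun_prop) (by fun_prop) (by fun_prop) n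
      fun k _ => (regular_of_norm_sub_one_lt (γ := 1) (by simp)).2 k).hasDerivAt
  have hbb : ∀ n, b' n 1 = coeffL a q α β 1 δ n := fun n => by
    simp only [hb', qPrime_one]; norm_num
  have hev : ∀ᶠ γ : ℂ in 𝓝 1, Regular γ ∧ Regular (2 - γ) := by
    have : ∀ᶠ s : ℂ in 𝓝 1, ‖s - 1‖ < 1 :=
      (isOpen_lt (by fun_prop) (by fun_prop)).mem_nhds (by simp)
    filter_upwards [this] with s hs using regular_of_norm_sub_one_lt hs
  -- the coefficients of both recurrences are polynomials in `γ` of degree at most two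
  have hlin : ∀ u v : ℂ, HasDerivAt (fun γ : ℂ => u + v * γ) v 1 := fun u v => by
    simpa using ((hasDerivAt_id (1 : ℂ)).const_mul v).const_add u
  have hquad : ∀ u v w : ℂ, HasDerivAt (fun γ : ℂ => u + v * γ + w * γ ^ 2) (v + 2 * w) 1 :=
    fun u v w => ((hlin u v).add ((hasDerivAt_pow 2 (1 : ℂ)).const_mul w)).congr_deriv (by
      simp; ring)
  have hP : ∀ m : ℕ, HasDerivAt (fun γ => P a γ m) (a * m) 1 := fun m =>
    (hlin (a * m * (m - 1)) (a * m)).congr_of_eventuallyEq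
      (Eventually.of_forall fun γ => by simp only [P]; ring)
  have hP' : ∀ m : ℕ, HasDerivAt (fun γ => P a (2 - γ) m) (-(a * m)) 1 := fun m =>
    (hlin (a * m * (m + 1)) (-(a * m))).congr_of_eventuallyEq
      (Eventually.of_forall fun γ => by simp only [P]; ring)
  have hQ : ∀ m : ℕ, HasDerivAt (fun γ => Q a q α β γ δ m) ((m - 1) * a) 1 := fun m =>
    (hlin (q + (m - 1) * ((a + 1) * (m - 2) + (α + β + 1 - δ) + a * δ))
      ((m - 1) * a)).congr_of_eventuallyEq
      (Eventually.of_forall fun γ => by simp only [Q, eps]; ring)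
  have hQ' : ∀ m : ℕ, HasDerivAt
      (fun γ => Q a (qPrime a q α β γ δ) (α - γ + 1) (β - γ + 1) (2 - γ) δ m)
      (-(α + β - δ + a * δ) - (m - 1) * (a + 2)) 1 := fun m =>
    ((hquad (q + (α + β + 1 - δ + a * δ) + (m - 1) * ((a + 1) * m + (α + β + 1 - δ) + a * δ))
      (-(α + β + 1 - δ + a * δ) - 1 - (m - 1) * (a + 2)) 1).congr_of_eventuallyEq
      (Eventually.of_forall fun γ => by simp only [Q, qPrime, eps]; ring)).congr_deriv (by ring)
  have hR' : ∀ m : ℕ, HasDerivAt (fun γ => R (α - γ + 1) (β - γ + 1) m) (-(U α β m)) 1 := fun m =>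
    ((hquad (-((m - 1 + α) * (m - 1 + β))) (2 * m - 2 + α + β) (-1)).congr_of_eventuallyEq
      (Eventually.of_forall fun γ => by simp only [R]; ring)).congr_deriv (by simp only [U]; ring)
  have hP1 : ∀ m : ℕ, P a (2 - 1) m = P a 1 m := fun m => by norm_num
  have hQ1 : ∀ m : ℕ, Q a (qPrime a q α β 1 δ) (α - 1 + 1) (β - 1 + 1) (2 - 1) δ m =
    Q a q α β 1 δ m := fun m => by rw [qPrime_one]; norm_num
  have hR1 : ∀ m : ℕ, R (α - 1 + 1) (β - 1 + 1) m = R α β m := fun m => by norm_num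
  induction n using Nat.strong_induction_on with
  | _ n ih =>
    match n with
    | 0 => simp [coeffD, hb, hb', coeffL]
    | 1 =>
      have e1 : (fun γ => P a γ 1 * b 1 γ) =ᶠ[𝓝 1] fun γ => Q a q α β γ δ 1 := by
        filter_upwards [hev] with γ hγ
        simp only [hb, coeffL]
        exact mul_div_cancel₀ _ (P_ne_zero ha (hγ.1 0))
      have e2 : (fun γ => P a (2 - γ) 1 * b' 1 γ) =ᶠ[𝓝 1]
          fun γ => Q a (qPrime a q α β γ δ) (α - γ + 1) (β - γ + 1) (2 - γ) δ 1 := by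
        filter_upwards [hev] with γ hγ
        simp only [hb', coeffL]
        exact mul_div_cancel₀ _ (P_ne_zero ha (hγ.2 0))
      have d1 := ((hP 1).mul (hd 1)).unique ((hQ 1).congr_of_eventuallyEq e1)
      have d2 := ((hP' 1).mul (hd' 1)).unique ((hQ' 1).congr_of_eventuallyEq e2)
      rw [hP1, hbb] at d2
      rw [coeffD, div_eq_iff (P_ne_zero ha (regular_one 0))]
      simp only [S, T, eps, coeffL, hb] at d1 d2 ⊢
      push_cast at d1 d2 ⊢
      linear_combination d2 - d1
    | m + 2 =>
      have e1 : (fun γ => P a γ (m + 2) * b (m + 2) γ) =ᶠ[𝓝 1]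
          fun γ => Q a q α β γ δ (m + 2) * b (m + 1) γ + R α β (m + 2) * b m γ := by
        filter_upwards [hev] with γ hγ using coeffL_rec ha (hγ.1 _)
      have e2 : (fun γ => P a (2 - γ) (m + 2) * b' (m + 2) γ) =ᶠ[𝓝 1]
          fun γ => Q a (qPrime a q α β γ δ) (α - γ + 1) (β - γ + 1) (2 - γ) δ (m + 2) *
            b' (m + 1) γ + R (α - γ + 1) (β - γ + 1) (m + 2) * b' m γ := by
        filter_upwards [hev] with γ hγ using coeffL_rec ha (hγ.2 _)
      have d1 := ((hP (m + 2)).mul (hd (m + 2))).unique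
        ((((hQ (m + 2)).mul (hd (m + 1))).add ((hd m).const_mul _)).congr_of_eventuallyEq e1)
      have d2 := ((hP' (m + 2)).mul (hd' (m + 2))).unique
        ((((hQ' (m + 2)).mul (hd' (m + 1))).add
          ((hR' (m + 2)).mul (hd' m))).congr_of_eventuallyEq e2)
      rw [hP1, hbb, hQ1, hbb, hR1, hbb] at d2
      rw [coeffD, div_eq_iff (P_ne_zero ha (regular_one (m + 1))), ih m (by omega),
        ih (m + 1) (by omega)]
      simp only [S, T, eps, hb] at d1 d2 ⊢
      push_cast at d1 d2 ⊢
      linear_combination d2 - d1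

/-- The analytic continuation of `∑ d n z ^ n`. -/
lemma isContinuation_coeffD {a : ℂ} (ha : a ≠ 0) (q α β δ : ℂ) :
    IsContinuation a (coeffD a q α β δ) (fun z => deriv (fun γ => heunL a q α β γ δ z) 1 -
      deriv (fun γ => heunLTransformed a q α β γ δ z) 1) := by
  have h1 := isContinuation_iff.1 (isContinuation_deriv ha δ (t := 1)
    (g := fun γ => (q, α, β, γ)) (by fun_prop) regular_one)
  have hq : Differentiable ℂ fun γ => qPrime a q α β γ δ := fun γ =>
    differentiableAt_qPrime (by fun_prop) (by fun_prop) (by fun_prop) (by fun_prop)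
  have h2 := isContinuation_iff.1 (isContinuation_deriv ha δ (t := 1)
    (g := fun γ => (qPrime a q α β γ δ, α - γ + 1, β - γ + 1, 2 - γ)) (by fun_prop)
    (regular_of_norm_sub_one_lt (γ := 1) (by simp)).2)
  exact isContinuation_iff.2 ⟨h1.1.sub h2.1,
    (h1.2.sub h2.2).congr_coeff fun n => (coeffD_eq ha q α β δ n).symm⟩

/-- Heun's operator at `γ = 1`, multiplied by `z ^ 2 * (z - 1) * (z - a)`. -/
noncomputable def eulerOp (a q α β δ : ℂ) (f : ℂ → ℂ) (z : ℂ) : ℂ :=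
  (z - 1) * (z - a) * (z * deriv f z + z ^ 2 * deriv (deriv f) z)
    + (z * (z - a) * δ + z * (z - 1) * eps α β 1 δ) * (z * deriv f z)
    + z * ((z * (α * β) - q) * f z)

lemma analyticOnNhd_eulerOp {D : Set ℂ} (a q α β δ : ℂ) {f : ℂ → ℂ} (hf : AnalyticOnNhd ℂ f D) :
    AnalyticOnNhd ℂ (eulerOp a q α β δ f) D := by
  intro z hz
  have h0 := hf z hz
  have h1 := h0.deriv
  have h2 := h1.deriv
  unfold eulerOp
  fun_prop

lemma hasSer_eulerOp (a q α β δ : ℂ) {f : ℂ → ℂ} {c : ℕ → ℂ} (hf : HasSer f c) :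
    HasSer (eulerOp a q α β δ f) (fun n => P a 1 n * c n -
      shift (fun m => Q a q α β 1 δ (m + 1) * c m + shift (fun l => R α β (l + 2) * c l) m) n) := by
  have h := hasSer_euler (a := a) (ν := 0) (q := q) (α := α) (β := β) (γ := 1) (δ := δ)
    (ε := eps α β 1 δ) (by simp only [eps]; ring) hf (by simpa using hf.theta)
    (by simpa using hf.theta.theta)
  refine (h.congr ?_).congr_coeff fun n => ?_
  · filter_upwards [hf.analyticAt.eventually_analyticAt] with z hz
    have hd : HasDerivAt (fun w => w * deriv f w) (1 * deriv f z + z * deriv (deriv f) z) z :=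
      (hasDerivAt_id z).mul hz.deriv.differentiableAt.hasDerivAt
    rw [hd.deriv]
    simp only [eulerOp, smul_eq_mul]
    ring
  · have e1 : ∀ n : ℕ, pA a (1 : ℂ) (n + 0) = P a 1 n := fun n => by
      simp only [pA, P, smul_eq_mul]; ring
    have e2 : ∀ n : ℕ, qA a q 1 δ (eps α β 1 δ) (n + 0) = Q a q α β 1 δ (n + 1) := fun n => by
      simp only [qA, Q, smul_eq_mul]; push_cast; ring
    have e3 : ∀ n : ℕ, rA α β (n + 0) = R α β (n + 2) := fun n => by
      simp only [rA, R, smul_eq_mul]; push_cast; ring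
    simp only [e1, e2, e3]

lemma eulerOp_heunL {a : ℂ} (ha : a ≠ 0) (q α β δ : ℂ) :
    EqOn (eulerOp a q α β δ (heunL a q α β 1 δ)) 0 (starDomain a) := by
  have h := isContinuation_iff.1 (isContinuation_heunL ha q α β δ regular_one)
  refine eqOn_starDomain ha (analyticOnNhd_eulerOp a q α β δ h.1) analyticOnNhd_const ?_
  refine ((hasSer_eulerOp a q α β δ h.2).congr_coeff fun n => ?_).eventuallyEq hasSer_zero
  match n with
  | 0 => simp [shift, P]
  | 1 =>
    simp only [shift, coeffL, add_zero, mul_one, zero_add]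
    rw [mul_div_cancel₀ _ (P_ne_zero ha (regular_one 0)), sub_self]
  | n + 2 =>
    simp only [shift]
    rw [coeffL_rec ha (regular_one _), sub_self]

/-- The equation of the non-logarithmic part: the right-hand side comes from the derivatives of the
logarithm. -/
lemma eulerOp_coeffD {a : ℂ} (ha : a ≠ 0) (q α β δ : ℂ) {w : ℂ → ℂ}
    (hw : IsContinuation a (coeffD a q α β δ) w) :
    EqOn (eulerOp a q α β δ w) (fun z => -(2 * (z - 1) * (z - a) *
      (z * deriv (heunL a q α β 1 δ) z) + z * (δ * (z - a) + eps α β 1 δ * (z - 1)) *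
        heunL a q α β 1 δ z)) (starDomain a) := by
  have h := isContinuation_iff.1 (isContinuation_heunL ha q α β δ regular_one)
  have hw := isContinuation_iff.1 hw
  refine eqOn_starDomain ha (analyticOnNhd_eulerOp a q α β δ hw.1) (fun z hz => ?_) ?_
  · have h0 := h.1 z hz
    have h1 := h0.deriv
    fun_prop
  have hθ := h.2.theta
  have hr := ((hθ.const_smul (-(2 * a))).add ((h.2.const_smul (eps α β 1 δ + a * δ)).add
    (hθ.const_smul (2 * (a + 1)))).smul_id).sub
    ((h.2.const_smul (α + β)).add (hθ.const_smul 2)).smul_id.smul_id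
  refine ((hasSer_eulerOp a q α β δ hw.2).congr_coeff fun n => ?_).eventuallyEq (hr.congr
    (Eventually.of_forall fun z => ?_))
  · match n with
    | 0 => simp [shift, P]
    | 1 =>
      simp only [shift, coeffD, mul_zero, add_zero, sub_zero]
      rw [mul_div_cancel₀ _ (P_ne_zero ha (regular_one 0))]
      simp only [S, T, smul_eq_mul]
      push_cast
      ring
    | n + 2 =>
      simp only [shift, coeffD]
      rw [mul_div_cancel₀ _ (P_ne_zero ha (regular_one (n + 1)))]
      simp only [S, T, U, smul_eq_mul]
      push_cast
      ring
  · simp only [smul_eq_mul, eps]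
    ring

lemma isOpen_cutDomain {a : ℂ} (ha : a ≠ 0) : IsOpen (cutDomain a) :=
  (isOpen_starDomain ha).inter Complex.isOpen_slitPlane

/-- The sum of the non-logarithmic part and of `log z * HeunL` solves Heun's equation. -/
lemma isSolutionOn_log {a : ℂ} (ha : a ≠ 0) (q α β δ : ℂ) {w : ℂ → ℂ}
    (hw : IsContinuation a (coeffD a q α β δ) w) {f : ℂ → ℂ}
    (hf : EqOn f (fun z => w z + Complex.log z * heunL a q α β 1 δ z) (cutDomain a)) :
    IsSolutionOn a q α β 1 δ (cutDomain a) f := by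
  have hh := (isContinuation_heunL ha q α β δ regular_one).1
  have hwa := hw.1
  have hCo := isOpen_cutDomain ha
  set h := heunL a q α β 1 δ with hh_def
  refine ⟨AnalyticOnNhd.congr hCo (fun z hz => ?_) hf.symm, fun z hz => ?_⟩
  · exact (hwa z hz.1).add ((analyticAt_clog hz.2).mul (hh z hz.1))
  have hz0 : z ≠ 0 := Complex.slitPlane_ne_zero hz.2
  have hd1 : EqOn (deriv f) (fun z => deriv w z + (z⁻¹ * h z + Complex.log z * deriv h z))
      (cutDomain a) := by
    intro y hy
    rw [(hf.eventuallyEq_of_mem (hCo.mem_nhds hy)).deriv_eq]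
    exact ((hwa y hy.1).differentiableAt.hasDerivAt.add ((Complex.hasDerivAt_log hy.2).mul
      (hh y hy.1).differentiableAt.hasDerivAt)).deriv
  have hd2 : deriv (deriv f) z = deriv (deriv w) z + ((-(z ^ 2)⁻¹ * h z + z⁻¹ * deriv h z) +
      (z⁻¹ * deriv h z + Complex.log z * deriv (deriv h) z)) := by
    rw [(hd1.eventuallyEq_of_mem (hCo.mem_nhds hz)).deriv_eq]
    exact ((hwa z hz.1).deriv.differentiableAt.hasDerivAt.add
      (((hasDerivAt_inv hz0).mul (hh z hz.1).differentiableAt.hasDerivAt).add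
        ((Complex.hasDerivAt_log hz.2).mul (hh z hz.1).deriv.differentiableAt.hasDerivAt))).deriv
  have z1 := sub_one_ne_zero_of_mem hz.1
  have za := sub_ne_zero_of_mem hz.1
  have E1 := eulerOp_heunL ha q α β δ hz.1
  have E2 := eulerOp_coeffD ha q α β δ hw hz.1
  simp only [eulerOp, Pi.zero_apply, ← hh_def] at E1 E2
  have e1 : z * deriv f z = z * deriv w z + h z + Complex.log z * (z * deriv h z) := by
    rw [hd1 hz]; field_simp; ring
  have e2 : z ^ 2 * deriv (deriv f) z = z ^ 2 * deriv (deriv w) z + 2 * (z * deriv h z) - h z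
      + Complex.log z * (z ^ 2 * deriv (deriv h) z) := by
    rw [hd2]; field_simp; ring
  have key : z ^ 2 * (z - 1) * (z - a) * (deriv (deriv f) z
      + (1 / z + δ / (z - 1) + eps α β 1 δ / (z - a)) * deriv f z
      + (α * β * z - q) / (z * (z - 1) * (z - a)) * f z) =
      (z - 1) * (z - a) * (z * deriv f z + z ^ 2 * deriv (deriv f) z)
      + (z * (z - a) * δ + z * (z - 1) * eps α β 1 δ) * (z * deriv f z)
      + z * ((z * (α * β) - q) * f z) := by
    field_simp
    ring
  have hne : z ^ 2 * (z - 1) * (z - a) ≠ 0 := mul_ne_zero (mul_ne_zero (pow_ne_zero 2 hz0) z1) za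
  refine (mul_eq_zero.1 (key.trans ?_)).resolve_left hne
  rw [e1, e2, hf hz]
  linear_combination Complex.log z * E1 + E2

end Logarithmic

end Heun

theorem mainTheorem2 (a q α β δ : ℂ) (ha0 : a ≠ 0) (ha1 : a ≠ 1) :
    -- the functions `HeunL` and `∑ d n * z ^ n` are well defined on the star domain
    (∀ γ : ℂ, (∀ n : ℕ, γ ≠ -(n : ℂ)) →
      Heun.IsContinuation a (Heun.coeffL a q α β γ δ) (Heun.heunL a q α β γ δ)) ∧
    Heun.IsContinuation a (Heun.coeffD a q α β δ)
      (Heun.continuation a (Heun.coeffD a q α β δ)) ∧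
    -- the limits that define the regularized functions at the centres of the discs exist
    (∀ z ∈ Heun.cutDomain a, ∀ n : ℕ,
      Tendsto (fun γ : ℂ => Heun.heunLCorrected n a q α β γ δ z) (𝓝[≠] (-(n : ℂ)))
        (𝓝 (Heun.heunLReg a q α β (-(n : ℂ)) δ z))) ∧
    (∀ z ∈ Heun.cutDomain a,
      Tendsto (fun γ : ℂ => Heun.heunSCorrected a q α β γ δ z) (𝓝[≠] (1 : ℂ))
        (𝓝 (Heun.heunSReg a q α β 1 δ z))) ∧
    -- smooth dependence on `γ`
    (∀ z ∈ Heun.cutDomain a, ContDiff ℝ ∞ (fun γ : ℂ => Heun.heunSReg a q α β γ δ z)) ∧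
    -- the limit of the quotient as `γ → 1`
    (∀ z ∈ Heun.cutDomain a,
      DifferentiableAt ℂ (fun γ : ℂ => Heun.heunLTransformed a q α β γ δ z) 1 ∧
      DifferentiableAt ℂ (fun γ : ℂ => Heun.heunL a q α β γ δ z) 1 ∧
      Tendsto
        (fun γ : ℂ => (Heun.heunS a q α β γ δ z - Heun.heunL a q α β γ δ z) / (1 - γ))
        (𝓝[≠] (1 : ℂ))
        (𝓝 (Complex.log z * Heun.heunL a q α β 1 δ z
          - (deriv (fun γ : ℂ => Heun.heunLTransformed a q α β γ δ z) 1
            - deriv (fun γ : ℂ => Heun.heunL a q α β γ δ z) 1))) ∧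
      Heun.heunSReg a q α β 1 δ z = Complex.log z * Heun.heunL a q α β 1 δ z
          - (deriv (fun γ : ℂ => Heun.heunLTransformed a q α β γ δ z) 1
            - deriv (fun γ : ℂ => Heun.heunL a q α β γ δ z) 1)) ∧
    -- this limit is the logarithmic solution for some `B`
    (∃ B : ℂ, ∀ z ∈ Heun.cutDomain a,
      Heun.heunSReg a q α β 1 δ z = Heun.heunSLog a q α β δ B z) ∧
    Heun.IsSolutionOn a q α β 1 δ (Heun.cutDomain a)
      (fun z : ℂ => Heun.heunSReg a q α β 1 δ z) := by
  have hD := Heun.isContinuation_coeffD ha0 q α β δ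
  have hval : ∀ z ∈ Heun.cutDomain a, Heun.heunSReg a q α β 1 δ z =
      Complex.log z * Heun.heunL a q α β 1 δ z
          - (deriv (fun γ : ℂ => Heun.heunLTransformed a q α β γ δ z) 1
            - deriv (fun γ : ℂ => Heun.heunL a q α β γ δ z) 1) := fun z hz => by
    rw [Heun.heunSReg_one ha0 hz, Heun.heunSQuotient_one ha0 hz]
  refine ⟨fun γ hγ => Heun.isContinuation_heunL ha0 q α β δ hγ,
    Heun.isContinuation_continuation hD, fun z hz n => ?_, fun z hz => ?_,
    fun z hz => Heun.contDiff_heunSReg ha0 hz q α β δ, fun z hz => ⟨?_, ?_, ?_, hval z hz⟩,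
    ⟨0, fun z hz => ?_⟩, Heun.isSolutionOn_log ha0 q α β δ hD fun z hz => ?_⟩
  · rw [Heun.heunLReg_center ha0 hz]
    exact Heun.tendsto_heunLCorrected ha0 hz n q α β
  · rw [Heun.heunSReg_one ha0 hz]
    exact Heun.tendsto_heunSCorrected ha0 hz q α β δ
  · exact Heun.differentiableAt_heunLTransformed_one ha0 hz.1 q α β δ
  · exact Heun.differentiableAt_heunL_one ha0 hz.1 q α β δ
  · rw [← Heun.heunSQuotient_one ha0 hz]
    have h := (Heun.differentiableAt_heunSQuotient ha0 hz q α β δ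
      (γ := 1) (by simp)).continuousAt.tendsto
    refine (h.mono_left nhdsWithin_le_nhds).congr' ?_
    filter_upwards [self_mem_nhdsWithin] with γ hγ using Heun.heunSQuotient_of_ne hγ
  · rw [hval z hz, Heun.heunSLog, hD.continuation_eq ha0 hz.1]
    ring
  · dsimp only
    rw [hval z hz]
    ring
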